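/- **Network.** Let $G=(\mathcal V,\mathcal E)$ be a finite acyclic ADT network: each supernode $V\in\mathcal V$ has a finite set $I(V)$ of input ports and a finite set $O(V)$ of output ports, $\mathcal E$ is a set of edges from output ports to input ports, and the directed graph on $\mathcal V$ with $V\to W$ whenever some edge runs from $O(V)$ to $I(W)$ has no directed cycle. Let $\mathbb F_q$ be a finite field. For supernodes $S\neq T$, $mincut(S,T)=\min_\Omega \operatorname{rank}(G_\Omega)$, where $\Omega$ ranges over the sets of supernodes with $S\in\Omega$, $T\notin\Omega$, and $G_\Omega$ is the $0$–$1$ incidence matrix over $\mathbb F_q$ between the output ports in $\Omega$ and the input ports in $\Omega^c$. **Codes.** The source $S$ multicasts $R=|\mathcal X(S)|$ processes to destinations $T_1,\dots,T_N\ne S$. A code assigns values in $\mathbb F_q$ to the code variables: $\alpha_{(k,e)}$ ($1\le k\le R$, $e\in O(S)$), $\beta_{(e',e)}$ ($e'\in I(V)$, $e\in O(V)$, $V\in\mathcal V$) and $\epsilon_{(e',(T_i,k))}$ ($e'\in I(T_i)$, $1\le k\le R$). Let $F$ be the matrix on the set of all ports with entry $1$ at $(e,e')\in\mathcal E$, entry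 $\beta_{(e',e)}$ at $(e',e)\in I(V)\times O(V)$, and $0$ elsewhere; let $A$ be the encoding matrix with entries $\alpha_{(k,e)}$ at $(k,e)$ for $e\in O(S)$, and $0$ elsewhere; let $B_i$ be the decoding matrix with entries $\epsilon_{(e',(T_i,k))}$ at $(k,e')$ for $e'\in I(T_i)$, and $0$ elsewhere. The processes at the ports are $Y=\mathcal X(S)A(I-F)^{-1}$, and the output of $T_i$ is $\mathcal Z(T_i)=\mathcal X(S)M_i$ with $M_i=A(I-F)^{-1}B_i^{T}$. *$T_i$ can decode* if $\mathcal X(S)$ is a function of the symbols $Y(e')$, $e'\in I(T_i)$, that it receives. **Random coding.** Let $J$ be any set (some or all) of the code variables. The variables in $J$ are drawn independently and uniformly from $\mathbb F_q$, and the others have arbitrary fixed values. Let $\eta$ be the number of links carrying random combinations, that is, of output ports $e$ that are the tail of at least one edge and have at least one coefficient $\alpha_{(k,e)}$ or $\beta_{(e',e)}$ in $J$ (the edges leaving one output port form one broadcast link). Let $\delta$ be the maximum over $i$ of the number of $k$ such that some $\epsilon_{(e',(T_i,k))}$ is in $J$; thus $\delta=0$ if no decoding coefficient is random. **Corollary (Random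 Coding for Multicast).** Suppose that $q>N$ and $mincut(S,T_i)\ge R$ for all $i$. Then: 1. There is a code for which $M_1,\dots,M_N$ are all invertible. 2. If for each $i$ the fixed values can be completed, by some values for the variables in $J$, to a code for which $T_i$ can decode, then all destinations can decode simultaneously with probability at least $(1-\frac Nq)^{\eta}$. 3. If for each $i$ the fixed values can be completed, by some values for the variables in $J$, to a code for which $M_i$ is invertible, then $M_1,\dots,M_N$ are all invertible (so that every destination recovers $\mathcal X(S)$ from $\mathcal Z(T_i)$, formed with the drawn decoding coefficients) with probability at least $(1-\frac Nq)^{\eta+\delta}$. 4. $\eta\le|\mathcal E|$, and $\eta+\delta$ is at most the total number of ports. If all code variables are random, or more generally if the values fixed outside $J$ are those of a code as in 1, the conditions in 2 and 3 hold. -/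

import Mathlib

open scoped Matrix

/-- An ADT network: every input port and every output port belongs to a supernode, and the edges
run from output ports to input ports. All edges leaving one output port form one (broadcast)
link. -/
structure ADTNetwork (V I O : Type*) where
  /-- the supernode to which an input port belongs -/
  inNode : I → V
  /-- the supernode to which an output port belongs -/
  outNode : O → V
  /-- the edge set -/
  edges : Finset (O × I)

namespace ADTNetwork

variable {V I O : Type*}

/-- There is an edge from an output port of `v` to an input port of `w`. -/
def Link (G : ADTNetwork V I O) (v w : V) : Prop :=
  ∃ e ∈ G.edges, G.outNode e.1 = v ∧ G.inNode e.2 = w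

/-- The supernode graph has no directed cycle. -/
def Acyclic (G : ADTNetwork V I O) : Prop :=
  ∀ v, ¬ Relation.TransGen G.Link v v

/-- The set `I(v)` of input ports of a supernode. -/
abbrev InPort (G : ADTNetwork V I O) (v : V) : Type _ := {e : I // G.inNode e = v}

/-- The set `O(v)` of output ports of a supernode. -/
abbrev OutPort (G : ADTNetwork V I O) (v : V) : Type _ := {e : O // G.outNode e = v}

section MinCut

variable [Fintype I] [DecidableEq V] [DecidableEq I] [DecidableEq O]

/-- The incidence matrix `G_Ω`, over the field `F`, of the bipartite graph between the output
ports of the supernodes in `Ω` and the input ports of the supernodes outside `Ω`. -/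
def cutMatrix (G : ADTNetwork V I O) (F : Type*) [Field F] (Ω : Finset V) :
    Matrix {e : O // G.outNode e ∈ Ω} {e : I // G.inNode e ∉ Ω} F :=
  Matrix.of fun e e' => if (e.1, e'.1) ∈ G.edges then 1 else 0

/-- `mincut(S, T)`: the minimum of `rank G_Ω` over all cuts `Ω` with `S ∈ Ω` and `T ∉ Ω`. -/
noncomputable def mincut (G : ADTNetwork V I O) (F : Type*) [Field F] (S T : V) : ℕ :=
  sInf {r : ℕ | ∃ Ω : Finset V, S ∈ Ω ∧ T ∉ Ω ∧ (G.cutMatrix F Ω).rank = r}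

end MinCut

/-- The code variables for a multicast of `R` source processes from `S` to `T 0, …, T (N - 1)`:
* `α (k, e)` for a source process `k` and an output port `e` of `S`;
* `β (e', e)` for an input port `e'` and an output port `e` of one and the same supernode;
* `ε (e', (i, k))` for an input port `e'` of `T i` and an output process `k` of `T i`. -/
abbrev CodeVar (G : ADTNetwork V I O) (S : V) {N : ℕ} (T : Fin N → V) (R : ℕ) : Type _ :=
  (Fin R × G.OutPort S) ⊕ {p : I × O // G.inNode p.1 = G.outNode p.2} ⊕
    (Σ i : Fin N, G.InPort (T i) × Fin R)

variable {G : ADTNetwork V I O} {S : V} {N : ℕ} {T : Fin N → V} {R : ℕ}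

/-- The variable `α (k, e)`. -/
abbrev CodeVar.α (k : Fin R) (e : G.OutPort S) : G.CodeVar S T R := Sum.inl (k, e)

/-- The variable `β (e', e)`. -/
abbrev CodeVar.β (e' : I) (e : O) (h : G.inNode e' = G.outNode e) : G.CodeVar S T R :=
  Sum.inr (Sum.inl ⟨(e', e), h⟩)

/-- The variable `ε (e', (i, k))`. -/
abbrev CodeVar.ε (i : Fin N) (e' : G.InPort (T i)) (k : Fin R) : G.CodeVar S T R :=
  Sum.inr (Sum.inr ⟨i, e', k⟩)

section Coding

variable {F : Type*} [Field F] [DecidableEq V] [DecidableEq I] [DecidableEq O]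

/-- The adjacency matrix `F` on the ports, for the values `c` of the code variables. -/
def adjMatrix (c : G.CodeVar S T R → F) : Matrix (I ⊕ O) (I ⊕ O) F :=
  Matrix.of fun p p' =>
    match p, p' with
    | Sum.inr e, Sum.inl e' => if (e, e') ∈ G.edges then 1 else 0
    | Sum.inl e', Sum.inr e =>
        if h : G.inNode e' = G.outNode e then c (CodeVar.β e' e h) else 0
    | _, _ => 0

/-- The encoding matrix `A`. -/
def encMatrix (c : G.CodeVar S T R → F) : Matrix (Fin R) (I ⊕ O) F :=
  Matrix.of fun k p =>
    match p with
    | Sum.inr e => if h : G.outNode e = S then c (CodeVar.α k ⟨e, h⟩) else 0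
    | Sum.inl _ => 0

/-- The block `B i` of the decoding matrix that belongs to the destination `T i`. -/
def decMatrix (c : G.CodeVar S T R → F) (i : Fin N) : Matrix (Fin R) (I ⊕ O) F :=
  Matrix.of fun k p =>
    match p with
    | Sum.inl e' => if h : G.inNode e' = T i then c (CodeVar.ε i ⟨e', h⟩ k) else 0
    | Sum.inr _ => 0

variable [Fintype I] [Fintype O]

/-- The block `M i = A (1 - F)⁻¹ (B i)ᵀ` of the system matrix: `Z (T i) = X(S) * M i`. -/
noncomputable def systemMatrix (c : G.CodeVar S T R → F) (i : Fin N) :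
    Matrix (Fin R) (Fin R) F :=
  encMatrix c * (1 - adjMatrix c)⁻¹ * (decMatrix c i)ᵀ

/-- The symbols received at the input ports of `T i` when the source symbols are `x`. -/
noncomputable def received (c : G.CodeVar S T R → F) (i : Fin N) (x : Fin R → F) :
    G.InPort (T i) → F :=
  fun e => (x ᵥ* (encMatrix c * (1 - adjMatrix c)⁻¹)) (Sum.inl e.1)

/-- The destination `T i` can recover all source symbols from the symbols that it receives. -/
def CanDecode (c : G.CodeVar S T R → F) (i : Fin N) : Prop :=
  ∃ g : (G.InPort (T i) → F) → (Fin R → F), ∀ x, g (received c i x) = x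

end Coding

/-- `c` agrees with `c₀` at every code variable outside `J`. -/
def AgreeOff {F : Type*} (J : Set (G.CodeVar S T R)) (c₀ c : G.CodeVar S T R → F) : Prop :=
  ∀ v, v ∉ J → c v = c₀ v

/-- The probability of the event `P` when the code variables in `J` are drawn independently and
uniformly from the finite field `F` and the others keep their values in `c₀`, that is, when the
code is uniformly distributed over the finitely many `c` that agree with `c₀` outside `J`. -/
noncomputable def randomCodeProb {F : Type*} (J : Set (G.CodeVar S T R))
    (c₀ : G.CodeVar S T R → F) (P : (G.CodeVar S T R → F) → Prop) : ℝ :=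
  (Nat.card {c : G.CodeVar S T R → F // AgreeOff J c₀ c ∧ P c} : ℝ) /
    (Nat.card {c : G.CodeVar S T R → F // AgreeOff J c₀ c} : ℝ)

/-- `η`: the number of links that carry random combinations, that is, of output ports that are
the tail of some edge and have at least one random coefficient. -/
noncomputable def numRandomLinks (J : Set (G.CodeVar S T R)) : ℕ :=
  Nat.card {e : O // (∃ e', (e, e') ∈ G.edges) ∧
    ((∃ (k : Fin R) (h : G.outNode e = S), (CodeVar.α k ⟨e, h⟩ : G.CodeVar S T R) ∈ J) ∨
      ∃ (e' : I) (h : G.inNode e' = G.outNode e),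
        (CodeVar.β e' e h : G.CodeVar S T R) ∈ J)}

/-- `δ`: the largest number, over the destinations `T i`, of output processes of `T i` that are
formed with at least one random decoding coefficient. -/
noncomputable def numRandomOutputs (J : Set (G.CodeVar S T R)) : ℕ :=
  Finset.univ.sup fun i : Fin N =>
    Nat.card {k : Fin R // ∃ e' : G.InPort (T i), (CodeVar.ε i e' k : G.CodeVar S T R) ∈ J}

end ADTNetwork

/-!
The matrix `M i` has the determinant of the Edmonds matrix of the linear equations between the
symbols at the output ports and the outputs of `T i`. Each column of the latter involves only the
coefficients of one output port or of one output process, so `det (M i)` is affine in these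
coefficients jointly. Of `N` such functions, none of them identically zero, each vanishes at a
uniformly drawn point with probability at most `1 / q`, so none vanishes with probability at least
`1 - N / q`; drawing the groups one after the other multiplies these bounds. Only the
`η` links and `δ` outputs count, since a port without outgoing edges does not influence `M i`. For
decoding alone, one replaces the decoding matrix of `T i` by a fixed one that decodes some
completion of the fixed values.

It remains to find one code with `M i` invertible for each single `i`. Over an infinite field one
eliminates the supernodes other than `S` and `T i` one at a time, choosing the local coefficients of
the eliminated supernode so that every cut of the remaining network keeps rank at least `R`: a cut
with the supernode on either side already has that rank, so a generic choice preserves it. At the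
end the transfer matrix from `S` to `T i` has rank at least `R`. This applies to an algebraic
closure of `F`; as `det (M i)` is affine in each single variable, the variables can then be moved
to values in `{0, 1}`, which lie in `F`, without making it vanish.
-/

section Rank

variable {K m n k l : Type*} [Field K] [Fintype n]

theorem exists_mul_eq_one_of_vecMul_injective [Fintype m] [DecidableEq m] {Y : Matrix m n K}
    (hY : Function.Injective Y.vecMul) : ∃ b : Matrix n m K, Y * b = 1 := by
  classical
  obtain ⟨g, hg⟩ := LinearMap.exists_leftInverse_of_injective (Matrix.toLinearMapRight' Y)
    (LinearMap.ker_eq_bot.2 hY)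
  refine ⟨Matrix.toLinearMapRight'.symm g, Matrix.toLinearMapRight'.injective ?_⟩
  rw [Matrix.toLinearMapRight'_mul, LinearEquiv.apply_symm_apply, hg, Matrix.toLinearMapRight'_one]

theorem le_rank_iff_exists_mul_mul_eq_one [Fintype m] {Y : Matrix m n K} {r : ℕ} :
    r ≤ Y.rank ↔ ∃ (a : Matrix (Fin r) m K) (b : Matrix n (Fin r) K), a * Y * b = 1 := by
  constructor
  · intro h
    obtain ⟨f, hf⟩ := exists_linearIndependent_of_le_finrank (R := K)
      (M := LinearMap.range Y.mulVecLin) h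
    choose w hw using fun j => (f j).2
    let b : Matrix n (Fin r) K := Matrix.of fun x j => w j x
    have hrow : (Y * b)ᵀ.row = fun j => (f j : m → K) := funext fun j => hw j
    have hinj : Function.Injective (Y * b)ᵀ.vecMul := by
      rw [Matrix.vecMul_injective_iff, hrow]
      exact hf.map' (Submodule.subtype _) (Submodule.ker_subtype _)
    obtain ⟨a, ha⟩ := exists_mul_eq_one_of_vecMul_injective hinj
    refine ⟨aᵀ, b, ?_⟩
    rw [Matrix.mul_assoc, ← Matrix.transpose_transpose (Y * b), ← Matrix.transpose_mul, ha,
      Matrix.transpose_one]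
  · rintro ⟨a, b, hab⟩
    calc r = (a * (Y * b)).rank := by
          rw [← Matrix.mul_assoc, hab, Matrix.rank_one, Fintype.card_fin]
      _ ≤ (Y * b).rank := Matrix.rank_mul_le_right _ _
      _ ≤ Y.rank := Matrix.rank_mul_le_left _ _

theorem rank_add_finrank_ker_mulVecLin (A : Matrix m n K) :
    A.rank + Module.finrank K (LinearMap.ker A.mulVecLin) = Fintype.card n := by
  rw [Matrix.rank, LinearMap.finrank_range_add_finrank_ker, Module.finrank_fintype_fun_eq_card]

theorem exists_mulVec_eq_zero_and_mulVec_ne_zero {A : Matrix m n K} {B : Matrix l n K}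
    (h : A.rank < B.rank) : ∃ x, A *ᵥ x = 0 ∧ B *ᵥ x ≠ 0 := by
  by_contra! hker
  have hle : LinearMap.ker A.mulVecLin ≤ LinearMap.ker B.mulVecLin := hker
  have := Submodule.finrank_mono hle
  have := rank_add_finrank_ker_mulVecLin A
  have := rank_add_finrank_ker_mulVecLin B
  omega

theorem rank_lt_rank_of_ker_lt {A : Matrix m n K} {B : Matrix l n K}
    (h : LinearMap.ker B.mulVecLin < LinearMap.ker A.mulVecLin) : A.rank < B.rank := by
  have := Submodule.finrank_lt_finrank_of_lt h
  have := rank_add_finrank_ker_mulVecLin A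
  have := rank_add_finrank_ker_mulVecLin B
  omega

theorem rank_lt_rank_add_vecMulVec [Fintype m] {M : Matrix m n K} {x w : n → K} {y u : m → K}
    (hx : M *ᵥ x = 0) (hy : y ᵥ* M = 0) (hw : w ⬝ᵥ x ≠ 0) (hu : y ⬝ᵥ u ≠ 0) :
    M.rank < (M + Matrix.vecMulVec u w).rank := by
  have happly (z : n → K) : (M + Matrix.vecMulVec u w) *ᵥ z = M *ᵥ z + (w ⬝ᵥ z) • u := by
    rw [Matrix.add_mulVec, Matrix.vecMulVec_mulVec, op_smul_eq_smul]
  refine rank_lt_rank_of_ker_lt (SetLike.lt_iff_le_and_exists.2 ⟨fun z hz => ?_, x, hx, ?_⟩)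
  · rw [LinearMap.mem_ker, Matrix.mulVecLin_apply, happly] at hz
    have hwz : w ⬝ᵥ z = 0 := by
      have h := congrArg (y ⬝ᵥ ·) hz
      simpa [dotProduct_add, Matrix.dotProduct_mulVec, hy, hu] using h
    simpa [hwz] using hz
  · intro hmem
    rw [LinearMap.mem_ker, Matrix.mulVecLin_apply, happly, hx, zero_add, smul_eq_zero] at hmem
    rcases hmem with h | h
    · exact hw h
    · exact hu (by rw [h, dotProduct_zero])

theorem exists_mulVec_eq_zero_of_rank_lt_fromRows [Fintype l] {P : Matrix m n K}
    {U : Matrix l n K} {C : Matrix m l K} (h : (P + C * U).rank < (Matrix.fromRows P U).rank) :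
    ∃ x, (P + C * U) *ᵥ x = 0 ∧ U *ᵥ x ≠ 0 := by
  obtain ⟨x, hx, hne⟩ := exists_mulVec_eq_zero_and_mulVec_ne_zero h
  refine ⟨x, hx, fun hUx => hne ?_⟩
  have hPx : P *ᵥ x = 0 := by
    rwa [Matrix.add_mulVec, ← Matrix.mulVec_mulVec, hUx, Matrix.mulVec_zero, add_zero] at hx
  rw [Matrix.fromRows_mulVec, hPx, hUx]
  exact Sum.elim_zero_zero

theorem exists_vecMul_eq_zero_of_rank_lt_fromCols [Fintype m] [Fintype k] {P : Matrix m n K}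
    {Q : Matrix m k K} {C : Matrix k n K} (h : (P + Q * C).rank < (Matrix.fromCols P Q).rank) :
    ∃ y, y ᵥ* (P + Q * C) = 0 ∧ y ᵥ* Q ≠ 0 := by
  rw [← Matrix.rank_transpose, ← Matrix.rank_transpose (Matrix.fromCols P Q),
    Matrix.transpose_fromCols, Matrix.transpose_add, Matrix.transpose_mul] at h
  obtain ⟨y, hy, hne⟩ := exists_mulVec_eq_zero_of_rank_lt_fromRows h
  rw [← Matrix.transpose_mul, ← Matrix.transpose_add, Matrix.mulVec_transpose] at hy
  exact ⟨y, hy, by rwa [Matrix.mulVec_transpose] at hne⟩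

/- While the rank is below `R`, changing one entry of `β`, chosen where the left and the right
kernel of `P + Q β U` are both seen, raises it. -/
theorem exists_le_rank_add_mul_mul [Finite m] [Fintype k] [Fintype l] {P : Matrix m n K}
    {Q : Matrix m k K} {U : Matrix l n K} {R : ℕ}
    (hQ : R ≤ (Matrix.fromCols P Q).rank) (hU : R ≤ (Matrix.fromRows P U).rank) :
    ∃ β : Matrix k l K, R ≤ (P + Q * β * U).rank := by
  classical
  have := Fintype.ofFinite m
  suffices h : ∀ r ≤ R, ∃ β : Matrix k l K, r ≤ (P + Q * β * U).rank from h R le_rfl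
  intro r
  induction r with
  | zero => exact fun _ => ⟨0, Nat.zero_le _⟩
  | succ r ih =>
    intro hr
    obtain ⟨β, hβ⟩ := ih (by omega)
    obtain hlt | hge := lt_or_ge (P + Q * β * U).rank R
    · obtain ⟨x, hx, hUx⟩ := exists_mulVec_eq_zero_of_rank_lt_fromRows (hlt.trans_le hU)
      rw [Matrix.mul_assoc] at hlt
      obtain ⟨y, hy, hyQ⟩ := exists_vecMul_eq_zero_of_rank_lt_fromCols (hlt.trans_le hQ)
      rw [← Matrix.mul_assoc] at hy
      obtain ⟨i, hi⟩ := Function.ne_iff.1 hUx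
      obtain ⟨j, hj⟩ := Function.ne_iff.1 hyQ
      have hsingle : P + Q * (β + Matrix.single j i 1) * U =
          P + Q * β * U + Matrix.vecMulVec (Q.col j) (U.row i) := by
        rw [Matrix.mul_add, Matrix.add_mul, ← add_assoc, Matrix.single_eq_single_vecMulVec_single,
          Matrix.mul_vecMulVec, Matrix.vecMulVec_mul, Matrix.mulVec_single_one,
          Matrix.single_one_vecMul]
      refine ⟨β + Matrix.single j i 1, hβ.trans_lt ?_⟩
      rw [hsingle]
      exact rank_lt_rank_add_vecMulVec hx hy hi hj
    · exact ⟨β, hr.trans hge⟩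

theorem le_rank_map [Finite m] {K' : Type*} [Field K'] (f : K →+* K') {Y : Matrix m n K} {r : ℕ}
    (h : r ≤ Y.rank) : r ≤ (Y.map f).rank := by
  have := Fintype.ofFinite m
  obtain ⟨a, b, hab⟩ := le_rank_iff_exists_mul_mul_eq_one.1 h
  refine le_rank_iff_exists_mul_mul_eq_one.2 ⟨a.map f, b.map f, ?_⟩
  rw [← Matrix.map_mul, ← Matrix.map_mul, hab, Matrix.map_one f f.map_zero f.map_one]

end Rank

section RankAtPoints

open MvPolynomial

variable {K σ : Type*} [Field K]

theorem exists_mvPolynomial_le_rank_map_eval {m n : Type*} [Finite m] [Fintype n]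
    {Y : Matrix m n (MvPolynomial σ K)} {r : ℕ} {x₀ : σ → K} (h : r ≤ (Y.map (eval x₀)).rank) :
    ∃ p : MvPolynomial σ K, p ≠ 0 ∧ ∀ x, eval x p ≠ 0 → r ≤ (Y.map (eval x)).rank := by
  have := Fintype.ofFinite m
  obtain ⟨a, b, hab⟩ := le_rank_iff_exists_mul_mul_eq_one.1 h
  let p : MvPolynomial σ K := (a.map (C (σ := σ)) * Y * b.map (C (σ := σ))).det
  have heval (x : σ → K) : eval x p = (a * Y.map (eval x) * b).det := by
    have ha : (a.map (C (σ := σ))).map (eval x) = a := by ext; simp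
    have hb : (b.map (C (σ := σ))).map (eval x) = b := by ext; simp
    rw [RingHom.map_det, RingHom.mapMatrix_apply, Matrix.map_mul, Matrix.map_mul, ha, hb]
  refine ⟨p, fun h0 => ?_, fun x hx => ?_⟩
  · have := heval x₀
    rw [h0, map_zero, hab, Matrix.det_one] at this
    exact zero_ne_one this
  · rw [heval] at hx
    refine le_rank_iff_exists_mul_mul_eq_one.2 ⟨(a * Y.map (eval x) * b)⁻¹ * a, b, ?_⟩
    rw [Matrix.mul_assoc, Matrix.mul_assoc, ← Matrix.mul_assoc a,
      Matrix.nonsing_inv_mul _ (isUnit_iff_ne_zero.2 hx)]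

theorem exists_forall_le_rank_map_eval [Infinite K] {ι : Type*} [Finite ι] {m n : ι → Type*}
    [∀ i, Finite (m i)] [∀ i, Fintype (n i)] {Y : ∀ i, Matrix (m i) (n i) (MvPolynomial σ K)}
    {r : ℕ} (h : ∀ i, ∃ x, r ≤ ((Y i).map (eval x)).rank) :
    ∃ x, ∀ i, r ≤ ((Y i).map (eval x)).rank := by
  have := Fintype.ofFinite ι
  choose x₀ hx₀ using h
  choose p hp0 hp using fun i => exists_mvPolynomial_le_rank_map_eval (hx₀ i)
  obtain ⟨x, hx⟩ : ∃ x, eval x (∏ i, p i) ≠ 0 := by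
    by_contra! hzero
    exact Finset.prod_ne_zero_iff.2 (fun i _ => hp0 i)
      (MvPolynomial.funext fun x => by rw [hzero, map_zero])
  rw [map_prod, Finset.prod_ne_zero_iff] at hx
  exact ⟨x, fun i => hp i x (hx i (Finset.mem_univ i))⟩

theorem exists_forall_le_rank_add_mul_mul [Infinite K] {ι k l : Type*} [Finite ι] [Fintype k]
    [Fintype l] {m n : ι → Type*} [∀ i, Finite (m i)] [∀ i, Fintype (n i)]
    {P : ∀ i, Matrix (m i) (n i) K} {Q : ∀ i, Matrix (m i) k K} {U : ∀ i, Matrix l (n i) K} {R : ℕ}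
    (hQ : ∀ i, R ≤ (Matrix.fromCols (P i) (Q i)).rank)
    (hU : ∀ i, R ≤ (Matrix.fromRows (P i) (U i)).rank) :
    ∃ β : Matrix k l K, ∀ i, R ≤ (P i + Q i * β * U i).rank := by
  let Y (i : ι) : Matrix (m i) (n i) (MvPolynomial (k × l) K) :=
    (P i).map (C (σ := k × l)) +
      (Q i).map (C (σ := k × l)) * Matrix.mvPolynomialX k l K * (U i).map (C (σ := k × l))
  have heval (β : Matrix k l K) (i : ι) :
      (Y i).map (eval fun p => β p.1 p.2) = P i + Q i * β * U i := by
    ext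
    simp [Y, Matrix.mul_apply]
  obtain ⟨x, hx⟩ := exists_forall_le_rank_map_eval (Y := Y) (r := R) fun i => by
    obtain ⟨β, hβ⟩ := exists_le_rank_add_mul_mul (hQ i) (hU i)
    exact ⟨fun p => β p.1 p.2, (heval β i).symm ▸ hβ⟩
  exact ⟨Matrix.of fun i j => x (i, j), fun i => heval (Matrix.of fun i j => x (i, j)) i ▸ hx i⟩

end RankAtPoints

section Determinants

variable {n K : Type*} [Fintype n] [DecidableEq n] [CommRing K]

theorem det_one_sub_eq_one_of_lt {α : Type*} [LinearOrder α] {A : Matrix n n K} (b : n → α)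
    (h : ∀ i j, A i j ≠ 0 → b i < b j) : (1 - A).det = 1 := by
  have hA (i j : n) (hij : ¬b i < b j) : A i j = 0 := not_not.1 (mt (h i j) hij)
  have htri : (1 - A).BlockTriangular b := fun i j hji => by
    rw [Matrix.sub_apply, Matrix.one_apply_ne (ne_of_apply_ne b hji.ne'), hA i j hji.not_gt,
      sub_zero]
  rw [htri.det]
  refine Finset.prod_eq_one fun a _ => ?_
  have hblock : (1 - A).toSquareBlock b a = 1 := by
    ext i j
    rw [Matrix.toSquareBlock, Matrix.toSquareBlockProp, Matrix.toBlock_apply, Matrix.sub_apply,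
      hA _ _ (by rw [i.2, j.2]; exact lt_irrefl a), sub_zero, Matrix.one_apply, Matrix.one_apply]
    simp only [Subtype.ext_iff]
  rw [hblock, Matrix.det_one]

theorem det_add_smul_sub_of_eq_off_col {M M' M'' : Matrix n n K} {j : n}
    (h' : ∀ p q, q ≠ j → M' p q = M p q) (h'' : ∀ p q, q ≠ j → M'' p q = M p q) (t : K) :
    (M + t • (M' - M'')).det = M.det + t * (M'.det - M''.det) := by
  have hM' : M' = M.updateCol j (M'.col j) := by
    ext p q
    obtain rfl | hq := eq_or_ne q j <;> simp [*]
  have hM'' : M'' = M.updateCol j (M''.col j) := by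
    ext p q
    obtain rfl | hq := eq_or_ne q j <;> simp [*]
  have hM : M + t • (M' - M'') =
      M.updateCol j (M.col j + t • (M'.col j + (-1 : K) • M''.col j)) := by
    ext p q
    obtain rfl | hq := eq_or_ne q j
    · simp [sub_eq_add_neg]
    · simp [hq, h' p q hq, h'' p q hq]
  rw [hM, Matrix.det_updateCol_add, Matrix.det_updateCol_smul, Matrix.det_updateCol_add,
    Matrix.det_updateCol_smul, ← hM', ← hM'',
    show M.updateCol j (M.col j) = M from Matrix.updateCol_eq_self M j]
  ring

end Determinants

section Elimination

variable {K I O : Type*} [Field K]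

theorem rank_toBlock_le_rank_fromCols [Fintype I] {X : Matrix O I K} {p : O → Prop}
    {q q₁ q₂ : I → Prop} [DecidablePred q] [DecidablePred q₁] [DecidablePred q₂]
    (h : ∀ i, q i → q₁ i ∨ q₂ i) :
    (X.toBlock p q).rank ≤ (Matrix.fromCols (X.toBlock p q₁) (X.toBlock p q₂)).rank := by
  let f (i : {i // q i}) : {i // q₁ i} ⊕ {i // q₂ i} :=
    if h₁ : q₁ i then Sum.inl ⟨i, h₁⟩ else Sum.inr ⟨i, (h i i.2).resolve_left h₁⟩
  have hf : X.toBlock p q =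
      (Matrix.fromCols (X.toBlock p q₁) (X.toBlock p q₂)).submatrix id f := by
    ext o i
    by_cases h₁ : q₁ i <;> simp [f, h₁]
  rw [hf]
  exact Matrix.rank_submatrix_le _ _ _

theorem rank_toBlock_le_rank_fromRows [Fintype I] {X : Matrix O I K} {p p₁ p₂ : O → Prop}
    {q q' : I → Prop} [DecidablePred q] [DecidablePred q'] (hp : ∀ o, p o → p₁ o ∨ p₂ o)
    (hq : ∀ i, q i → q' i) :
    (X.toBlock p q).rank ≤ (Matrix.fromRows (X.toBlock p₁ q') (X.toBlock p₂ q')).rank := by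
  classical
  let f (o : {o // p o}) : {o // p₁ o} ⊕ {o // p₂ o} :=
    if h₁ : p₁ o then Sum.inl ⟨o, h₁⟩ else Sum.inr ⟨o, (hp o o.2).resolve_left h₁⟩
  have hf : X.toBlock p q = (Matrix.fromRows (X.toBlock p₁ q') (X.toBlock p₂ q')).submatrix f
      (Subtype.map id hq) := by
    ext o i
    by_cases h₁ : p₁ o <;> simp [f, h₁]
  rw [hf]
  exact Matrix.rank_submatrix_le _ _ _

variable {V : Type*} [Fintype I] [DecidableEq V] {inn : I → V} {out : O → V}

/-- Every cut `Ω` between `s` and `t` that avoids the vertices in `U` transfers at least `R`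
dimensions through `X`. Here `X` is the matrix of path gains through the vertices in `U`, so that
these have been eliminated from the network and count for neither side of the cut. -/
def CutsHaveRank (inn : I → V) (out : O → V) (s t : V) (R : ℕ) (U : Finset V)
    (X : Matrix O I K) : Prop :=
  ∀ Ω : Finset V, s ∈ Ω → t ∉ Ω → Disjoint Ω U →
    R ≤ (X.toBlock (fun o => out o ∈ Ω) (fun i => inn i ∉ Ω ∪ U)).rank

theorem CutsHaveRank.map [Finite O] {K' : Type*} [Field K'] (f : K →+* K') {s t : V} {R : ℕ}
    {U : Finset V} {X : Matrix O I K} (hX : CutsHaveRank inn out s t R U X) :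
    CutsHaveRank inn out s t R U (X.map f) :=
  fun Ω hs ht hU => le_rank_map f (hX Ω hs ht hU)

variable [Fintype O]

theorem toBlock_mul_mul_of_support {l n : Type*} {p' : l → Prop} {q' : n → Prop}
    {p : I → Prop} {q : O → Prop} [DecidablePred p] [DecidablePred q] {B : Matrix I O K}
    (hB : ∀ i o, B i o ≠ 0 → p i ∧ q o) (X : Matrix l I K) (Y : Matrix O n K) :
    (X * B * Y).toBlock p' q' = X.toBlock p' p * B.toBlock p q * Y.toBlock q q' := by
  have hB_row : B.toBlock (fun i => ¬p i) q = 0 := by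
    ext i o
    exact not_not.1 (mt (hB i o) fun h => i.2 h.1)
  have hB_col : B.toBlock ⊤ (fun o => ¬q o) = 0 := by
    ext i o
    exact not_not.1 (mt (hB i o) fun h => o.2 h.2)
  rw [Matrix.toBlock_mul_eq_add p' q, Matrix.toBlock_mul_eq_mul (B := B) (q := fun o => ¬q o),
    hB_col, Matrix.mul_zero, Matrix.zero_mul, add_zero, Matrix.toBlock_mul_eq_add p' p, hB_row,
    Matrix.mul_zero, add_zero]

theorem CutsHaveRank.exists_eliminate [Infinite K] [Finite V] {s t v : V} {R : ℕ} {U : Finset V}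
    {X : Matrix O I K} (hX : CutsHaveRank inn out s t R U X) (hv : v ∉ U) (hvt : v ≠ t) :
    ∃ B : Matrix I O K, (∀ i o, B i o ≠ 0 → inn i = v ∧ out o = v) ∧
      CutsHaveRank inn out s t R (insert v U) (X + X * B * X) := by
  have := Fintype.ofFinite V
  let Cut := {Ω : Finset V // s ∈ Ω ∧ t ∉ Ω ∧ Disjoint Ω (insert v U)}
  obtain ⟨γ, hγ⟩ := exists_forall_le_rank_add_mul_mul (ι := Cut) (R := R)
    (P := fun Ω => X.toBlock (fun o => out o ∈ Ω.1) fun i => inn i ∉ Ω.1 ∪ insert v U)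
    (Q := fun Ω => X.toBlock (fun o => out o ∈ Ω.1) fun i => inn i = v)
    (U := fun Ω => X.toBlock (fun o => out o = v) fun i => inn i ∉ Ω.1 ∪ insert v U)
    (fun ⟨Ω, hs, ht, hΩ⟩ => by
      rw [Finset.disjoint_insert_right] at hΩ
      refine (hX Ω hs ht hΩ.2).trans (rank_toBlock_le_rank_fromCols fun i => ?_)
      simp only [Finset.mem_union, Finset.mem_insert]
      tauto)
    (fun ⟨Ω, hs, ht, hΩ⟩ => by
      rw [Finset.disjoint_insert_right] at hΩ
      refine (hX (insert v Ω) (Finset.mem_insert_of_mem hs)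
        (by simp [ht, hvt.symm]) (Finset.disjoint_insert_left.2 ⟨hv, hΩ.2⟩)).trans
          (rank_toBlock_le_rank_fromRows (fun o => ?_) fun i => ?_)
      · rw [Finset.mem_insert, or_comm]
        exact id
      · simp only [Finset.mem_union, Finset.mem_insert]
        tauto)
  let B : Matrix I O K := Matrix.of fun i o =>
    if h : inn i = v ∧ out o = v then γ ⟨i, h.1⟩ ⟨o, h.2⟩ else 0
  have hB (i : I) (o : O) (h : B i o ≠ 0) : inn i = v ∧ out o = v := by
    by_contra hne
    exact h (dif_neg hne)
  have hBγ : B.toBlock (fun i => inn i = v) (fun o => out o = v) = γ := by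
    ext i o
    exact dif_pos ⟨i.2, o.2⟩
  refine ⟨B, hB, fun Ω hs ht hΩ => ?_⟩
  have := hγ ⟨Ω, hs, ht, hΩ⟩
  rwa [← hBγ, ← toBlock_mul_mul_of_support hB] at this

theorem eliminate_eq {E X : Matrix O I K} {β B : Matrix I O K} (hX : X = E + X * β * E)
    (hB : B * X * B = 0) :
    X + X * B * X = E + (X + X * B * X) * (β + B) * E := by
  calc X + X * B * X = (E + X * β * E) + X * B * (E + X * β * E) + X * (B * X * B) * E := by
        rw [hB, ← hX, Matrix.mul_zero, Matrix.zero_mul, add_zero]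
    _ = E + (X + X * B * X) * (β + B) * E := by
        simp only [Matrix.mul_add, Matrix.add_mul, Matrix.mul_assoc]
        abel

theorem exists_of_mul_mul_apply_ne_zero {l n : Type*} {X : Matrix l I K} {B : Matrix I O K}
    {Y : Matrix O n K} {a : l} {b : n} (h : (X * B * Y) a b ≠ 0) :
    ∃ i o, X a i ≠ 0 ∧ B i o ≠ 0 ∧ Y o b ≠ 0 := by
  obtain ⟨o, -, ho⟩ := Finset.exists_ne_zero_of_sum_ne_zero h
  obtain ⟨i, -, hi⟩ := Finset.exists_ne_zero_of_sum_ne_zero (left_ne_zero_of_mul ho)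
  exact ⟨i, o, left_ne_zero_of_mul hi, right_ne_zero_of_mul hi, right_ne_zero_of_mul ho⟩

theorem exists_local_of_cutsHaveRank [Infinite K] [Finite V] {s t : V} {R : ℕ} {E : Matrix O I K}
    {ρ : V → ℕ} (hρ : ∀ o i, E o i ≠ 0 → ρ (out o) < ρ (inn i))
    (hE : CutsHaveRank inn out s t R ∅ E) (U : Finset V) (ht : t ∉ U) :
    ∃ (β : Matrix I O K) (X : Matrix O I K), (∀ i o, β i o ≠ 0 → inn i = out o) ∧
      X = E + X * β * E ∧ (∀ o i, X o i ≠ 0 → ρ (out o) < ρ (inn i)) ∧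
      CutsHaveRank inn out s t R U X := by
  induction U using Finset.induction_on with
  | empty => exact ⟨0, E, by simp, by simp, hρ, hE⟩
  | insert v U hv ih =>
    rw [Finset.mem_insert, not_or] at ht
    obtain ⟨β, X, hβ, hX, hXρ, hcut⟩ := ih ht.2
    obtain ⟨B, hB, hcutB⟩ := hcut.exists_eliminate hv (Ne.symm ht.1)
    have hBXB : B * X * B = 0 := by
      ext i o
      by_contra hne
      obtain ⟨o', i', h₁, h₂, h₃⟩ := exists_of_mul_mul_apply_ne_zero hne
      have := hXρ o' i' h₂
      rw [(hB _ _ h₁).2, (hB _ _ h₃).1] at this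
      exact this.false
    refine ⟨β + B, X + X * B * X, fun i o h => ?_, eliminate_eq hX hBXB, fun o i h => ?_, hcutB⟩
    · by_cases hBio : B i o = 0
      · exact hβ i o (by rwa [Matrix.add_apply, hBio, add_zero] at h)
      · rw [(hB i o hBio).1, (hB i o hBio).2]
    · by_cases hXoi : X o i = 0
      · rw [Matrix.add_apply, hXoi, zero_add] at h
        obtain ⟨i', o', h₁, h₂, h₃⟩ := exists_of_mul_mul_apply_ne_zero h
        calc ρ (out o) < ρ (inn i') := hXρ _ _ h₁
          _ = ρ (out o') := by rw [(hB _ _ h₂).1, (hB _ _ h₂).2]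
          _ < ρ (inn i) := hXρ _ _ h₃
      · exact hXρ o i hXoi

theorem exists_local_le_rank_of_cutsHaveRank [Infinite K] [Finite V] {s t : V} {R : ℕ}
    {E : Matrix O I K} {ρ : V → ℕ} (hρ : ∀ o i, E o i ≠ 0 → ρ (out o) < ρ (inn i))
    (hst : s ≠ t) (hE : CutsHaveRank inn out s t R ∅ E) :
    ∃ (β : Matrix I O K) (X : Matrix O I K), (∀ i o, β i o ≠ 0 → inn i = out o) ∧
      X = E + X * β * E ∧ R ≤ (X.toBlock (fun o => out o = s) (fun i => inn i = t)).rank := by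
  have := Fintype.ofFinite V
  obtain ⟨β, X, hβ, hX, -, hcut⟩ := exists_local_of_cutsHaveRank hρ hE {s, t}ᶜ (by simp)
  refine ⟨β, X, hβ, hX, (hcut {s} (by simp) (by simpa using hst.symm) (by simp)).trans ?_⟩
  have hout (o : O) (h : out o ∈ ({s} : Finset V)) : out o = s := Finset.mem_singleton.1 h
  have hinn (i : I) (h : inn i ∉ ({s} : Finset V) ∪ {s, t}ᶜ) : inn i = t := by
    by_contra hne
    exact h (by by_cases hs : inn i = s <;> simp [hs, hne])
  exact Matrix.rank_submatrix_le (X.toBlock (fun o => out o = s) fun i => inn i = t)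
    (Subtype.map id hout) (Subtype.map id hinn)

end Elimination

section AffineIn

variable {X F : Type*} [CommRing F]

/-- `h` is affine in the variables of `s` jointly, the other variables being fixed. Three points
`c`, `c'`, `c''` are used because over the field with two elements every function is affine along
each line. -/
def AffineIn (s : Set X) (h : (X → F) → F) : Prop :=
  ∀ ⦃c c' c'' : X → F⦄ (a : F), Set.EqOn c' c sᶜ → Set.EqOn c'' c sᶜ →
    h (c + a • (c' - c'')) = h c + a * (h c' - h c'')

theorem AffineIn.mono {s t : Set X} {h : (X → F) → F} (hh : AffineIn t h) (hst : s ⊆ t) :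
    AffineIn s h :=
  fun _ _ _ a h' h'' =>
    hh a (h'.mono (Set.compl_subset_compl.2 hst)) (h''.mono (Set.compl_subset_compl.2 hst))

theorem AffineIn.comp_piecewise {s : Set X} {h : (X → F) → F} (hh : AffineIn s h) (t : Set X)
    [DecidablePred (· ∈ t)] (d : X → F) : AffineIn s fun c => h (t.piecewise d c) := by
  intro c c' c'' a h' h''
  have hadd : t.piecewise d (c + a • (c' - c'')) =
      t.piecewise d c + a • (t.piecewise d c' - t.piecewise d c'') := by
    ext v
    by_cases hv : v ∈ t <;> simp [hv]
  have heq {b : X → F} (hb : Set.EqOn b c sᶜ) :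
      Set.EqOn (t.piecewise d b) (t.piecewise d c) sᶜ := by
    intro v hvs
    by_cases hv : v ∈ t <;> simp [hv, hb hvs]
  simp only [hadd]
  exact hh a (heq h') (heq h'')

theorem AffineIn.exists_update_zero_one_ne_zero [DecidableEq X] {h : (X → F) → F} {v : X}
    (hh : AffineIn {v} h) {c : X → F} (hc : h c ≠ 0) :
    ∃ a : F, (a = 0 ∨ a = 1) ∧ h (Function.update c v a) ≠ 0 := by
  by_contra! hzero
  have hoff (a b : F) : Set.EqOn (Function.update c v a) (Function.update c v b) {v}ᶜ :=
    fun w hw => by rw [Function.update_of_ne hw, Function.update_of_ne hw]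
  have hline := hh (c v) (hoff 1 0) (hoff 0 0)
  have hc' : Function.update c v 0 + c v • (Function.update c v 1 - Function.update c v 0) = c := by
    ext w
    obtain rfl | hw := eq_or_ne w v <;> simp [*]
  rw [hc', hzero 0 (Or.inl rfl), hzero 1 (Or.inr rfl), sub_self, mul_zero, add_zero] at hline
  exact hc hline

theorem exists_zero_one_ne_zero_of_affineIn [Finite X] {h : (X → F) → F}
    (hh : ∀ v, AffineIn {v} h) {c : X → F} (hc : h c ≠ 0) :
    ∃ c' : X → F, (∀ v, c' v = 0 ∨ c' v = 1) ∧ h c' ≠ 0 := by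
  classical
  have := Fintype.ofFinite X
  suffices H : ∀ s : Finset X, ∃ c' : X → F, (∀ v ∈ s, c' v = 0 ∨ c' v = 1) ∧ h c' ≠ 0 by
    obtain ⟨c', h01, hc'⟩ := H Finset.univ
    exact ⟨c', fun v => h01 v (Finset.mem_univ v), hc'⟩
  intro s
  induction s using Finset.induction_on with
  | empty => exact ⟨c, by simp, hc⟩
  | insert v s hv ih =>
    obtain ⟨c', h01, hc'⟩ := ih
    obtain ⟨a, ha, hne⟩ := (hh v).exists_update_zero_one_ne_zero hc'
    refine ⟨Function.update c' v a, fun w hw => ?_, hne⟩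
    obtain rfl | hwv := eq_or_ne w v
    · rwa [Function.update_self]
    · rw [Function.update_of_ne hwv]
      exact h01 w (Finset.mem_of_mem_insert_of_ne hw hwv)

end AffineIn

section Redraws

variable {X F : Type*} [Fintype X] [Fintype F]

open Classical in
/-- The assignments that arise from `c₀` when the variables in `s` are drawn anew. -/
noncomputable def redraws (s : Set X) (c₀ : X → F) : Finset (X → F) :=
  Finset.univ.filter fun c => Set.EqOn c c₀ sᶜ

theorem mem_redraws {s : Set X} {c₀ c : X → F} : c ∈ redraws s c₀ ↔ Set.EqOn c c₀ sᶜ := by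
  simp [redraws]

theorem card_redraws_pos (s : Set X) (c₀ : X → F) : 0 < (redraws s c₀).card :=
  Finset.card_pos.2 ⟨c₀, mem_redraws.2 (Set.eqOn_refl _ _)⟩

theorem card_redraws_eq (s : Set X) (c₀ c₁ : X → F) :
    (redraws s c₀).card = (redraws s c₁).card := by
  classical
  have hmaps (c₀ c₁ c : X → F) (_ : c ∈ redraws s c₀) : s.piecewise c c₁ ∈ redraws s c₁ :=
    mem_redraws.2 (Set.piecewise_eqOn_compl s c c₁)
  have hinv (c₀ c₁ c : X → F) (hc : c ∈ redraws s c₀) :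
      s.piecewise (s.piecewise c c₁) c₀ = c := by
    ext v
    by_cases hv : v ∈ s
    · simp [hv]
    · simp [hv, mem_redraws.1 hc hv]
  exact Finset.card_nbij' (s.piecewise · c₁) (s.piecewise · c₀) (hmaps c₀ c₁) (hmaps c₁ c₀)
    (hinv c₀ c₁) (hinv c₁ c₀)

theorem card_filter_redraws_union {s t : Set X} (hst : Disjoint s t) (c₀ : X → F)
    (p : (X → F) → Prop) [DecidablePred p] :
    ((redraws (s ∪ t) c₀).filter p).card = ∑ x ∈ redraws s c₀, ((redraws t x).filter p).card := by
  classical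
  have hmaps : ∀ c ∈ (redraws (s ∪ t) c₀).filter p, s.piecewise c c₀ ∈ redraws s c₀ :=
    fun c _ => mem_redraws.2 (Set.piecewise_eqOn_compl s c c₀)
  rw [Finset.card_eq_sum_card_fiberwise hmaps]
  refine Finset.sum_congr rfl fun x hx => congrArg Finset.card ?_
  ext c
  simp only [Finset.mem_filter, mem_redraws] at hx ⊢
  constructor
  · rintro ⟨⟨hc, hp⟩, rfl⟩
    refine ⟨fun v hv => ?_, hp⟩
    by_cases hvs : v ∈ s
    · simp [hvs]
    · rw [Set.piecewise_eq_of_notMem _ _ _ hvs]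
      exact hc (by simp_all)
  · rintro ⟨hc, hp⟩
    refine ⟨⟨fun v hv => ?_, hp⟩, ?_⟩
    · rw [Set.compl_union] at hv
      rw [hc hv.2, hx hv.1]
    · ext v
      by_cases hvs : v ∈ s
      · rw [Set.piecewise_eq_of_mem _ _ _ hvs, hc (Set.disjoint_left.1 hst hvs)]
      · rw [Set.piecewise_eq_of_notMem _ _ _ hvs, hx hvs]

theorem card_redraws_union {s t : Set X} (hst : Disjoint s t) (c₀ : X → F) :
    (redraws (s ∪ t) c₀).card = (redraws s c₀).card * (redraws t c₀).card := by
  have h := card_filter_redraws_union hst c₀ fun _ => True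
  simp only [Finset.filter_true] at h
  rw [h, Finset.sum_congr rfl fun x _ => card_redraws_eq t x c₀, Finset.sum_const, smul_eq_mul]

theorem mul_card_redraws_union_le {s t : Set X} (hst : Disjoint s t) {c₀ : X → F}
    {p q : (X → F) → Prop} [DecidablePred p] [DecidablePred q] {a b : ℝ} (hb : 0 ≤ b)
    (hp : a * (redraws s c₀).card ≤ ((redraws s c₀).filter p).card)
    (hq : ∀ x, p x → b * (redraws t x).card ≤ ((redraws t x).filter q).card) :
    a * b * (redraws (s ∪ t) c₀).card ≤ ((redraws (s ∪ t) c₀).filter q).card := by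
  have hbt : 0 ≤ b * (redraws t c₀).card := by positivity
  calc a * b * (redraws (s ∪ t) c₀).card
      = a * (redraws s c₀).card * (b * (redraws t c₀).card) := by
        rw [card_redraws_union hst]
        push_cast
        ring
    _ ≤ ((redraws s c₀).filter p).card * (b * (redraws t c₀).card) :=
        mul_le_mul_of_nonneg_right hp hbt
    _ = ∑ x ∈ (redraws s c₀).filter p, b * ((redraws t x).card : ℝ) := by
        rw [Finset.sum_congr rfl fun x _ => by rw [card_redraws_eq t x c₀], Finset.sum_const,
          nsmul_eq_mul]
    _ ≤ ∑ x ∈ (redraws s c₀).filter p, (((redraws t x).filter q).card : ℝ) :=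
        Finset.sum_le_sum fun x hx => hq x (Finset.mem_filter.1 hx).2
    _ ≤ ∑ x ∈ redraws s c₀, (((redraws t x).filter q).card : ℝ) :=
        Finset.sum_le_sum_of_subset_of_nonneg (Finset.filter_subset _ _) fun _ _ _ => by positivity
    _ = ((redraws (s ∪ t) c₀).filter q).card := by
        rw [card_filter_redraws_union hst]
        push_cast
        rfl

end Redraws

section NonvanishingDraws

variable {X F ι : Type*} [Fintype X] [Field F] [Fintype F] [DecidableEq F]

/- The translates of the zero set by the multiples of `c₁ - c₂`, where `c₂` is one of the zeros,
are disjoint because `h` takes the value `a * h c₁` on the translate by `a • (c₁ - c₂)`. -/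
theorem card_mul_card_zeros_le {s : Set X} {h : (X → F) → F} (hh : AffineIn s h) {c₀ c₁ : X → F}
    (hc₁ : c₁ ∈ redraws s c₀) (hne : h c₁ ≠ 0) :
    Fintype.card F * ((redraws s c₀).filter fun c => h c = 0).card ≤ (redraws s c₀).card := by
  obtain hempty | ⟨c₂, hc₂⟩ := ((redraws s c₀).filter fun c => h c = 0).eq_empty_or_nonempty
  · simp [hempty]
  rw [Finset.mem_filter, mem_redraws] at hc₂
  rw [mem_redraws] at hc₁
  have hval {c : X → F} (hc : Set.EqOn c c₀ sᶜ) (h0 : h c = 0) (a : F) :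
      h (c + a • (c₁ - c₂)) = a * h c₁ := by
    rw [hh a (hc₁.trans hc.symm) (hc₂.1.trans hc.symm), h0, hc₂.2, sub_zero, zero_add]
  rw [← Finset.card_univ, ← Finset.card_product]
  refine Finset.card_le_card_of_injOn (fun x => x.2 + x.1 • (c₁ - c₂)) (fun x hx => ?_)
    fun x hx y hy hxy => ?_
  · simp only [Finset.coe_product, Set.mem_prod, Finset.mem_coe, Finset.mem_filter,
      mem_redraws] at hx
    rw [Finset.mem_coe, mem_redraws]
    intro v hv
    simp [hx.2.1 hv, hc₁ hv, hc₂.1 hv]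
  · simp only [Finset.coe_product, Set.mem_prod, Finset.mem_coe, Finset.mem_filter,
      mem_redraws] at hx hy
    have hfst : x.1 = y.1 := by
      refine mul_right_cancel₀ hne ?_
      rw [← hval hx.2.1 hx.2.2, ← hval hy.2.1 hy.2.2]
      exact congrArg h hxy
    refine Prod.ext hfst (add_right_cancel (b := x.1 • (c₁ - c₂)) (hxy.trans ?_))
    rw [hfst]

variable [Fintype ι] {h : ι → (X → F) → F}

theorem one_sub_mul_card_redraws_le {s : Set X} (hh : ∀ i, AffineIn s (h i)) {c₀ : X → F}
    (hne : ∀ i, ∃ c ∈ redraws s c₀, h i c ≠ 0) :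
    (1 - (Fintype.card ι : ℝ) / Fintype.card F) * (redraws s c₀).card ≤
      ((redraws s c₀).filter fun c => ∀ i, h i c ≠ 0).card := by
  have hF : (0 : ℝ) < Fintype.card F := by exact_mod_cast Fintype.card_pos
  have hzeros (i : ι) : (((redraws s c₀).filter fun c => h i c = 0).card : ℝ) ≤
      (redraws s c₀).card / Fintype.card F := by
    obtain ⟨c, hc, hci⟩ := hne i
    rw [le_div_iff₀ hF, mul_comm]
    exact_mod_cast card_mul_card_zeros_le (hh i) hc hci
  have hbad : (((redraws s c₀).filter fun c => ¬∀ i, h i c ≠ 0).card : ℝ) ≤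
      Fintype.card ι * ((redraws s c₀).card / Fintype.card F) := by
    calc (((redraws s c₀).filter fun c => ¬∀ i, h i c ≠ 0).card : ℝ)
        ≤ (Finset.univ.biUnion fun i => (redraws s c₀).filter fun c => h i c = 0).card := by
          gcongr
          intro c
          simp
      _ ≤ ∑ i, (((redraws s c₀).filter fun c => h i c = 0).card : ℝ) := by
          exact_mod_cast Finset.card_biUnion_le
      _ ≤ ∑ _i : ι, ((redraws s c₀).card / Fintype.card F : ℝ) :=
          Finset.sum_le_sum fun i _ => hzeros i
      _ = Fintype.card ι * ((redraws s c₀).card / Fintype.card F) := by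
          rw [Finset.sum_const, Finset.card_univ, nsmul_eq_mul]
  have hsum := Finset.card_filter_add_card_filter_not (s := redraws s c₀) fun c => ∀ i, h i c ≠ 0
  rw [← @Nat.cast_inj ℝ, Nat.cast_add] at hsum
  rw [sub_mul, one_mul, div_mul_eq_mul_div, mul_div_assoc]
  linarith

theorem pow_card_mul_card_redraws_biUnion_le {κ : Type*} {Z : Set X} {s : κ → Set X}
    (hcard : Fintype.card ι ≤ Fintype.card F) (hZ : ∀ i, DependsOn (h i) Zᶜ)
    (hs : ∀ k i, AffineIn (s k) (h i)) (A : Finset κ) (c₀ : X → F)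
    (hne : ∀ i, ∃ c ∈ redraws (Z ∪ ⋃ k ∈ A, s k) c₀, h i c ≠ 0) :
    (1 - (Fintype.card ι : ℝ) / Fintype.card F) ^ A.card *
        (redraws (Z ∪ ⋃ k ∈ A, s k) c₀).card ≤
      ((redraws (Z ∪ ⋃ k ∈ A, s k) c₀).filter fun c => ∀ i, h i c ≠ 0).card := by
  classical
  induction A using Finset.induction_on generalizing c₀ with
  | empty =>
    rw [Finset.card_empty, pow_zero, one_mul, Finset.filter_true_of_mem]
    intro c hc i
    obtain ⟨d, hd, hdi⟩ := hne i
    simp only [Finset.notMem_empty, Set.iUnion_of_empty, Set.iUnion_empty, Set.union_empty,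
      mem_redraws] at hc hd
    rwa [hZ i (hc.trans hd.symm)]
  | insert k A hk ih =>
    have hJ : Z ∪ ⋃ k' ∈ insert k A, s k' =
        (s k \ (Z ∪ ⋃ k' ∈ A, s k')) ∪ (Z ∪ ⋃ k' ∈ A, s k') := by
      rw [Finset.set_biUnion_insert, Set.sdiff_union_self, Set.union_left_comm]
    rw [hJ] at hne ⊢
    generalize Z ∪ ⋃ k' ∈ A, s k' = J at ih hne ⊢
    choose d hd hdne using hne
    have hlive (i : ι) : ∃ c ∈ redraws (s k \ J) c₀, h i (J.piecewise (d i) c) ≠ 0 := by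
      refine ⟨J.piecewise c₀ (d i), mem_redraws.2 fun v hv => ?_, ?_⟩
      · by_cases hvJ : v ∈ J
        · rw [Set.piecewise_eq_of_mem _ _ _ hvJ]
        · rw [Set.piecewise_eq_of_notMem _ _ _ hvJ]
          exact mem_redraws.1 (hd i) (by simp_all)
      · convert hdne i
        ext v
        by_cases hvJ : v ∈ J <;> simp [hvJ]
    have hfst := one_sub_mul_card_redraws_le
      (fun i => ((hs k i).mono Set.sdiff_subset).comp_piecewise J (d i)) hlive
    have hsnd (x : X → F) (hx : ∀ i, h i (J.piecewise (d i) x) ≠ 0) :=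
      ih x fun i => ⟨_, mem_redraws.2 (Set.piecewise_eqOn_compl J (d i) x), hx i⟩
    have hbase : 0 ≤ 1 - (Fintype.card ι : ℝ) / Fintype.card F :=
      sub_nonneg.2 (div_le_one_of_le₀ (by exact_mod_cast hcard) (by positivity))
    rw [Finset.card_insert_of_notMem hk, pow_succ']
    exact mul_card_redraws_union_le Set.disjoint_sdiff_left (pow_nonneg hbase _) hfst hsnd

theorem pow_card_mul_card_redraws_le {κ : Type*} [Fintype κ] {J Z : Set X} {s : κ → Set X}
    (hJ : J ⊆ Z ∪ ⋃ k, s k) (hcard : Fintype.card ι ≤ Fintype.card F)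
    (hZ : ∀ i, DependsOn (h i) Zᶜ) (hs : ∀ k i, AffineIn (s k) (h i)) (c₀ : X → F)
    (hne : ∀ i, ∃ c ∈ redraws J c₀, h i c ≠ 0) :
    (1 - (Fintype.card ι : ℝ) / Fintype.card F) ^ Fintype.card κ * (redraws J c₀).card ≤
      ((redraws J c₀).filter fun c => ∀ i, h i c ≠ 0).card := by
  have hsplit : J = (J ∩ Z) ∪ ⋃ k ∈ (Finset.univ : Finset κ), J ∩ s k := by
    simp only [Finset.mem_univ, Set.iUnion_true]
    rw [← Set.inter_iUnion, ← Set.inter_union_distrib_left, Set.inter_eq_left.2 hJ]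
  rw [hsplit] at hne ⊢
  exact pow_card_mul_card_redraws_biUnion_le hcard
    (fun i => (hZ i).mono (Set.compl_subset_compl.2 Set.inter_subset_right))
    (fun k i => (hs k i).mono Set.inter_subset_right) Finset.univ c₀ hne

end NonvanishingDraws

section Matrices

variable {l m n R : Type*} [Fintype m]

theorem mul_congr_of_row_ne_zero [CommRing R] {A A' : Matrix l m R} {B : Matrix m n R}
    (h : ∀ i j, B j ≠ 0 → A i j = A' i j) : A * B = A' * B := by
  ext i k
  refine Finset.sum_congr rfl fun j _ => ?_
  by_cases hj : B j = 0
  · simp only [hj, Pi.zero_apply, mul_zero]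
  · exact congrArg (· * B j k) (h i j hj)

theorem mul_eq_submatrix_mul_submatrix [CommRing R] {A : Matrix l m R} {B : Matrix m n R}
    (p : m → Prop) [DecidablePred p] (h : ∀ i j k, ¬p j → A i j * B j k = 0) :
    A * B = A.submatrix id (Subtype.val : {j // p j} → m) * B.submatrix Subtype.val id := by
  ext i k
  rw [Matrix.mul_apply, ← Fintype.sum_subtype_add_sum_subtype p,
    Finset.sum_eq_zero (s := (Finset.univ : Finset {j // ¬p j})) fun j _ => h i j k j.2, add_zero]
  rfl

end Matrices

theorem exists_forall_mem_exists_eq_some {α : Type*} {D : Set α} [Finite D] {n : ℕ}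
    (hD : Nat.card D ≤ n) : ∃ g : Fin n → Option α, ∀ a ∈ D, ∃ j, g j = some a := by
  let f (a : D) : Fin n := Fin.castLE hD (Finite.equivFin D a)
  have hf : Function.Injective f := (Fin.castLE_injective hD).comp (Finite.equivFin D).injective
  exact ⟨Function.extend f (fun a => some a.1) fun _ => none,
    fun a ha => ⟨f ⟨a, ha⟩, hf.extend_apply _ _ _⟩⟩

namespace ADTNetwork

variable {V I O : Type*} {G : ADTNetwork V I O}

theorem Acyclic.exists_lt_of_link (hG : G.Acyclic) :
    ∃ ρ : V → ℕ, ∀ v w, G.Link v w → ρ v < ρ w := by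
  have hfin (w : V) : {v | Relation.TransGen G.Link v w}.Finite := by
    refine (G.edges.finite_toSet.image fun e => G.outNode e.1).subset fun v hv => ?_
    obtain ⟨_, ⟨e, he, hout, _⟩, _⟩ := Relation.TransGen.head'_iff.1 hv
    exact ⟨e, he, hout⟩
  refine ⟨fun w => {v | Relation.TransGen G.Link v w}.ncard, fun v w h => ?_⟩
  refine Set.ncard_lt_ncard ?_ (hfin w)
  exact (Set.ssubset_iff_of_subset fun u (hu : Relation.TransGen G.Link u v) =>
    hu.tail h).2 ⟨v, Relation.TransGen.single h, hG v⟩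

variable {S : V} {N : ℕ} {T : Fin N → V} {R : ℕ} {F : Type*}

/-- The output port or the output process of a destination in whose linear combination a code
variable is a coefficient. -/
def CodeVar.target : G.CodeVar S T R → O ⊕ (Fin N × Fin R)
  | Sum.inl (_, e) => Sum.inl e
  | Sum.inr (Sum.inl p) => Sum.inl p.1.2
  | Sum.inr (Sum.inr ⟨i, _, k⟩) => Sum.inr (i, k)

/-- The coefficients of the output ports that are the tail of some edge. -/
def linkVars : Set (G.CodeVar S T R) :=
  {v | ∃ e ∈ G.edges, v.target = Sum.inl e.1}

/-- The coefficients `ε (e', (i, k))` of the destination `T i`: the rows of `(decMatrix c i)ᵀ` at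
the input ports of `T i`. -/
def decodingMatrix (c : G.CodeVar S T R → F) (i : Fin N) : Matrix (G.InPort (T i)) (Fin R) F :=
  Matrix.of fun e' k => c (CodeVar.ε i e' k)

theorem dependsOn_decodingMatrix (i : Fin N) :
    DependsOn (fun c : G.CodeVar S T R → F => decodingMatrix c i)
      {v | ∃ k, v.target = Sum.inr (i, k)} := by
  intro c c' h
  ext e' k
  exact h _ ⟨k, rfl⟩

section Coding

variable [Field F]

theorem exists_decodingMatrix_eq {i : Fin N} (B : Matrix (G.InPort (T i)) (Fin R) F) :
    ∃ d : G.CodeVar S T R → F, decodingMatrix d i = B := by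
  classical
  refine ⟨Sum.elim 0 (Sum.elim 0 fun p =>
    if h : G.inNode p.2.1 = T i then B ⟨p.2.1, h⟩ p.2.2 else 0), ?_⟩
  ext e' k
  exact dif_pos e'.2

section Edges

variable [DecidableEq I] [DecidableEq O]

/-- The incidence matrix between all output ports and all input ports, of which the matrices
`cutMatrix` are the blocks. -/
def edgeMatrix (G : ADTNetwork V I O) (F : Type*) [Field F] : Matrix O I F :=
  Matrix.of fun e e' => if (e, e') ∈ G.edges then 1 else 0

theorem mem_edges_of_edgeMatrix_ne_zero {e : O} {e' : I}
    (h : G.edgeMatrix F e e' ≠ 0) : (e, e') ∈ G.edges := by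
  by_contra he
  exact h (if_neg he)

theorem edgeMatrix_map {K : Type*} [Field K] (f : F →+* K) :
    (G.edgeMatrix F).map f = G.edgeMatrix K := by
  ext e e'
  simp [edgeMatrix, apply_ite]

end Edges

section Coefficients

variable [DecidableEq V]

/-- The coefficients `β (e', e)`, with entry `0` where the ports `e'` and `e` belong to different
supernodes. -/
def localMatrix (c : G.CodeVar S T R → F) : Matrix I O F :=
  Matrix.of fun e' e => if h : G.inNode e' = G.outNode e then c (CodeVar.β e' e h) else 0

/-- The coefficients `α (k, e)`, with entry `0` where `e` is not a port of the source. -/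
def sourceMatrix (c : G.CodeVar S T R → F) : Matrix (Fin R) O F :=
  Matrix.of fun k e => if h : G.outNode e = S then c (CodeVar.α k ⟨e, h⟩) else 0

theorem encMatrix_eq_fromCols (c : G.CodeVar S T R → F) :
    encMatrix c = Matrix.fromCols 0 (sourceMatrix c) := by
  ext k (p | p) <;> rfl

end Coefficients

variable [DecidableEq V] [DecidableEq I] [DecidableEq O]

theorem one_sub_adjMatrix (c : G.CodeVar S T R → F) :
    1 - adjMatrix c = Matrix.fromBlocks 1 (-localMatrix c) (-G.edgeMatrix F) 1 := by
  ext (p | p) (q | q)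
  · simp [adjMatrix, Matrix.one_apply]
  · exact zero_sub _
  · exact zero_sub _
  · simp [adjMatrix, Matrix.one_apply]

variable [Fintype I]

theorem cutsHaveRank_edgeMatrix {s t : V} (hcut : R ≤ G.mincut F s t) :
    CutsHaveRank G.inNode G.outNode s t R ∅ (G.edgeMatrix F) := by
  intro Ω hs ht _
  rw [Finset.union_empty]
  exact hcut.trans (Nat.sInf_le ⟨Ω, hs, ht, rfl⟩)

/-- The matrix of the linear equations between the symbols at the output ports and the output
processes of `T i`. Its determinant is that of the system matrix, but unlike the entries of the
system matrix, those of each of its columns involve only the coefficients of a single output port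
or output process. -/
def edmondsMatrix (c : G.CodeVar S T R → F) (i : Fin N) :
    Matrix (O ⊕ Fin R) (O ⊕ Fin R) F :=
  Matrix.fromBlocks (1 - G.edgeMatrix F * localMatrix c)
    (-((G.edgeMatrix F).submatrix id (Subtype.val : G.InPort (T i) → I) * decodingMatrix c i))
    (sourceMatrix c) 0

theorem edmondsMatrix_add_smul_sub (c c' c'' : G.CodeVar S T R → F) (t : F) (i : Fin N) :
    edmondsMatrix (c + t • (c' - c'')) i =
      edmondsMatrix c i + t • (edmondsMatrix c' i - edmondsMatrix c'' i) := by
  have hlocal : localMatrix (c + t • (c' - c'')) =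
      localMatrix c + t • (localMatrix c' - localMatrix c'') := by
    ext e' e
    by_cases h : G.inNode e' = G.outNode e <;> simp [localMatrix, h]
  have hsource : sourceMatrix (c + t • (c' - c'')) =
      sourceMatrix c + t • (sourceMatrix c' - sourceMatrix c'') := by
    ext k e
    by_cases h : G.outNode e = S <;> simp [sourceMatrix, h]
  have hdec : decodingMatrix (c + t • (c' - c'')) i =
      decodingMatrix c i + t • (decodingMatrix c' i - decodingMatrix c'' i) := rfl
  simp only [edmondsMatrix, hlocal, hsource, hdec, Matrix.mul_add, Matrix.mul_sub,
    Matrix.mul_smul]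
  ext (p | p) (q | q)
  · simp only [Matrix.fromBlocks_apply₁₁, Matrix.add_apply, Matrix.sub_apply, Matrix.smul_apply,
      smul_eq_mul]
    ring
  · simp only [Matrix.fromBlocks_apply₁₂, Matrix.add_apply, Matrix.sub_apply, Matrix.neg_apply,
      Matrix.smul_apply, smul_eq_mul]
    ring
  · rfl
  · simp

theorem edmondsMatrix_map {K : Type*} [Field K] (f : F →+* K) (c : G.CodeVar S T R → F)
    (i : Fin N) : edmondsMatrix (f ∘ c) i = (edmondsMatrix c i).map f := by
  have hlocal : localMatrix (f ∘ c) = (localMatrix c).map f := by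
    ext e' e
    by_cases h : G.inNode e' = G.outNode e <;> simp [localMatrix, h]
  have hsource : sourceMatrix (f ∘ c) = (sourceMatrix c).map f := by
    ext k e
    by_cases h : G.outNode e = S <;> simp [sourceMatrix, h]
  have hdec : decodingMatrix (f ∘ c) i = (decodingMatrix c i).map f := rfl
  ext (p | p) (q | q)
  · simp [edmondsMatrix, hlocal, ← edgeMatrix_map f, ← Matrix.map_mul, Matrix.one_apply,
      apply_ite f]
  · simp [edmondsMatrix, hdec, ← edgeMatrix_map f, Matrix.mul_apply]
  · simp [edmondsMatrix, hsource]
  · simp [edmondsMatrix]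

theorem dependsOn_edmondsMatrix_apply (i : Fin N) (p q : O ⊕ Fin R) :
    DependsOn (fun c : G.CodeVar S T R → F => edmondsMatrix c i p q)
      {v | v.target = Sum.map id (Prod.mk i) q} := by
  intro c c' h
  rcases p with p | p <;> rcases q with q | q
  · refine congrArg ((1 : Matrix O O F) p q - ·)
      (Finset.sum_congr rfl fun e' _ => congrArg (_ * ·) ?_)
    exact dite_congr rfl (fun hnode => h _ rfl) fun _ => rfl
  · refine congrArg Neg.neg (Finset.sum_congr rfl fun e' _ => congrArg (_ * ·) ?_)
    exact h _ rfl
  · exact dite_congr rfl (fun hnode => h _ rfl) fun _ => rfl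
  · rfl

variable [Fintype O]

/-- The path gains from the output ports to the input ports, a path being one edge or several
edges joined by local coefficients: the sum of the Neumann series
`E + E * L + E * L * E + ⋯` over the edge matrix `E` and the local matrix `L`. -/
noncomputable def pathMatrix (c : G.CodeVar S T R → F) : Matrix O I F :=
  G.edgeMatrix F * (1 - localMatrix c * G.edgeMatrix F)⁻¹

/-- The matrix that takes the source symbols to the symbols received by `T i`. -/
noncomputable def receptionMatrix (c : G.CodeVar S T R → F) (i : Fin N) :
    Matrix (Fin R) (G.InPort (T i)) F :=
  (sourceMatrix c * pathMatrix c).submatrix id Subtype.val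

theorem Acyclic.det_one_sub_edgeMatrix_mul (hG : G.Acyclic) (c : G.CodeVar S T R → F) :
    (1 - G.edgeMatrix F * localMatrix c).det = 1 := by
  obtain ⟨ρ, hρ⟩ := hG.exists_lt_of_link
  refine det_one_sub_eq_one_of_lt (fun e => ρ (G.outNode e)) fun e₁ e₂ h => ?_
  obtain ⟨e', -, hne⟩ := Finset.exists_ne_zero_of_sum_ne_zero h
  have hedge := mem_edges_of_edgeMatrix_ne_zero (left_ne_zero_of_mul hne)
  have hlocal : G.inNode e' = G.outNode e₂ := by
    by_contra hnode
    exact right_ne_zero_of_mul hne (dif_neg hnode)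
  exact hρ _ _ ⟨_, hedge, rfl, hlocal⟩

theorem Acyclic.isUnit_det_one_sub_localMatrix_mul (hG : G.Acyclic) (c : G.CodeVar S T R → F) :
    IsUnit (1 - localMatrix c * G.edgeMatrix F).det := by
  rw [Matrix.det_one_sub_mul_comm, hG.det_one_sub_edgeMatrix_mul]
  exact isUnit_one

theorem Acyclic.isUnit_det_one_sub_adjMatrix (hG : G.Acyclic) (c : G.CodeVar S T R → F) :
    IsUnit (1 - adjMatrix c).det := by
  rw [one_sub_adjMatrix, Matrix.det_fromBlocks_one₁₁, Matrix.neg_mul, Matrix.mul_neg,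
    neg_neg, hG.det_one_sub_edgeMatrix_mul]
  exact isUnit_one

theorem Acyclic.pathMatrix_mul (hG : G.Acyclic) (c : G.CodeVar S T R → F) :
    pathMatrix c * (1 - localMatrix c * G.edgeMatrix F) = G.edgeMatrix F :=
  Matrix.nonsing_inv_mul_cancel_right _ _ (hG.isUnit_det_one_sub_localMatrix_mul c)

theorem Acyclic.pathMatrix_eq (hG : G.Acyclic) (c : G.CodeVar S T R → F) :
    pathMatrix c = (1 - G.edgeMatrix F * localMatrix c)⁻¹ * G.edgeMatrix F := by
  have hunit : IsUnit (1 - G.edgeMatrix F * localMatrix c).det := by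
    rw [hG.det_one_sub_edgeMatrix_mul]
    exact isUnit_one
  have hswap : (1 - G.edgeMatrix F * localMatrix c) * G.edgeMatrix F =
      G.edgeMatrix F * (1 - localMatrix c * G.edgeMatrix F) := by
    rw [Matrix.sub_mul, Matrix.mul_sub, Matrix.one_mul, Matrix.mul_one, Matrix.mul_assoc]
  rw [← Matrix.nonsing_inv_mul_cancel_left _ (pathMatrix c) hunit, pathMatrix,
    ← Matrix.mul_assoc (1 - _), hswap,
    Matrix.mul_nonsing_inv_cancel_right _ _ (hG.isUnit_det_one_sub_localMatrix_mul c)]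

theorem Acyclic.encMatrix_mul_inv (hG : G.Acyclic) (c : G.CodeVar S T R → F) :
    encMatrix c * (1 - adjMatrix c)⁻¹ = Matrix.fromCols (sourceMatrix c * pathMatrix c)
      (sourceMatrix c + sourceMatrix c * pathMatrix c * localMatrix c) := by
  have hpath := congrArg (sourceMatrix c * ·) (hG.pathMatrix_mul c)
  have hmul : Matrix.fromCols (sourceMatrix c * pathMatrix c)
      (sourceMatrix c + sourceMatrix c * pathMatrix c * localMatrix c) * (1 - adjMatrix c) =
        encMatrix c := by
    rw [one_sub_adjMatrix, encMatrix_eq_fromCols, Matrix.fromCols_mul_fromBlocks]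
    congr 1
    · rw [Matrix.mul_one, Matrix.mul_neg, Matrix.add_mul, ← hpath,
        Matrix.mul_sub, Matrix.mul_sub, Matrix.mul_one]
      simp only [Matrix.mul_assoc]
      abel
    · simp
  rw [← hmul, Matrix.mul_nonsing_inv_cancel_right _ _ (hG.isUnit_det_one_sub_adjMatrix c)]

theorem Acyclic.received_eq (hG : G.Acyclic) (c : G.CodeVar S T R → F) (i : Fin N)
    (x : Fin R → F) : received c i x = x ᵥ* receptionMatrix c i := by
  unfold received
  rw [hG.encMatrix_mul_inv]
  rfl

theorem Acyclic.systemMatrix_eq (hG : G.Acyclic) (c : G.CodeVar S T R → F) (i : Fin N) :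
    systemMatrix c i = receptionMatrix c i * decodingMatrix c i := by
  have hdec : (decMatrix c i)ᵀ = Matrix.fromRows ((decMatrix c i)ᵀ.toRows₁) 0 := by
    ext (p | p) k <;> rfl
  rw [systemMatrix, hG.encMatrix_mul_inv, hdec, Matrix.fromCols_mul_fromRows, Matrix.mul_zero,
    add_zero, mul_eq_submatrix_mul_submatrix (G.inNode · = T i) fun k e' k' h => ?_]
  · congr 1
    ext e' k
    exact dif_pos e'.2
  · simp [decMatrix, h]

theorem Acyclic.canDecode_iff_exists_det_ne_zero (hG : G.Acyclic) {c : G.CodeVar S T R → F}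
    {i : Fin N} :
    CanDecode c i ↔ ∃ B : Matrix (G.InPort (T i)) (Fin R) F, (receptionMatrix c i * B).det ≠ 0 := by
  constructor
  · rintro ⟨g, hg⟩
    have hinj : Function.Injective (receptionMatrix c i).vecMul := by
      refine Function.LeftInverse.injective (g := g) fun x => ?_
      rw [← hG.received_eq, hg]
    obtain ⟨B, hB⟩ := exists_mul_eq_one_of_vecMul_injective hinj
    exact ⟨B, by simp [hB]⟩
  · rintro ⟨B, hB⟩
    refine ⟨fun y => y ᵥ* (B * (receptionMatrix c i * B)⁻¹), fun x => ?_⟩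
    simp only [hG.received_eq, Matrix.vecMul_vecMul]
    rw [← Matrix.mul_assoc, Matrix.mul_nonsing_inv _ (isUnit_iff_ne_zero.2 hB), Matrix.vecMul_one]

theorem dependsOn_receptionMatrix (i : Fin N) :
    DependsOn (fun c : G.CodeVar S T R → F => receptionMatrix c i) linkVars := by
  intro c c' h
  have htail {e : O} (he : G.edgeMatrix F e ≠ 0) : ∃ e', (e, e') ∈ G.edges := by
    obtain ⟨e', he'⟩ := Function.ne_iff.1 he
    exact ⟨e', mem_edges_of_edgeMatrix_ne_zero he'⟩
  have hlocal : localMatrix c * G.edgeMatrix F = localMatrix c' * G.edgeMatrix F := by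
    refine mul_congr_of_row_ne_zero fun e' e he => ?_
    obtain ⟨e'', hmem⟩ := htail he
    exact dite_congr rfl (fun hnode => h _ ⟨_, hmem, rfl⟩) fun _ => rfl
  have hsource : sourceMatrix c * G.edgeMatrix F = sourceMatrix c' * G.edgeMatrix F := by
    refine mul_congr_of_row_ne_zero fun k e he => ?_
    obtain ⟨e'', hmem⟩ := htail he
    exact dite_congr rfl (fun hnode => h _ ⟨_, hmem, rfl⟩) fun _ => rfl
  simp only [receptionMatrix, pathMatrix, ← Matrix.mul_assoc, hlocal, hsource]

theorem Acyclic.dependsOn_systemMatrix (hG : G.Acyclic) (i : Fin N) :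
    DependsOn (fun c : G.CodeVar S T R → F => systemMatrix c i)
      (linkVars ∪ {v | ∃ k, v.target = Sum.inr (i, k)}) := by
  intro c c' h
  simp only [hG.systemMatrix_eq]
  exact congrArg₂ (· * ·) (dependsOn_receptionMatrix i fun v hv => h v (Or.inl hv))
    (dependsOn_decodingMatrix i fun v hv => h v (Or.inr hv))

theorem Acyclic.det_edmondsMatrix (hG : G.Acyclic) (c : G.CodeVar S T R → F) (i : Fin N) :
    (edmondsMatrix c i).det = (systemMatrix c i).det := by
  have hdet := hG.det_one_sub_edgeMatrix_mul c
  have := Matrix.invertibleOfIsUnitDet _ (hdet ▸ isUnit_one)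
  rw [edmondsMatrix, Matrix.det_fromBlocks₁₁, hdet, one_mul, Matrix.invOf_eq_nonsing_inv,
    Matrix.mul_neg, zero_sub, neg_neg, hG.systemMatrix_eq, receptionMatrix, hG.pathMatrix_eq,
    ← Matrix.mul_assoc (sourceMatrix c)]
  exact congrArg Matrix.det
    (Matrix.mul_assoc _ ((G.edgeMatrix F).submatrix id Subtype.val) _).symm

theorem Acyclic.affineIn_det_systemMatrix (hG : G.Acyclic) {i : Fin N}
    {s : Set (G.CodeVar S T R)} (q : Option (O ⊕ Fin R))
    (hs : ∀ v ∈ s, ∀ q', v.target = Sum.map id (Prod.mk i) q' → some q' = q) :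
    AffineIn s fun c : G.CodeVar S T R → F => (systemMatrix c i).det := by
  intro c c' c'' t h' h''
  have hcol {d : G.CodeVar S T R → F} (hd : Set.EqOn d c sᶜ) (p q' : O ⊕ Fin R)
      (hq : some q' ≠ q) : edmondsMatrix d i p q' = edmondsMatrix c i p q' :=
    dependsOn_edmondsMatrix_apply i p q' fun v hv => hd fun hvs => hq (hs v hvs q' hv)
  simp only [← hG.det_edmondsMatrix, edmondsMatrix_add_smul_sub]
  cases q with
  | none =>
    have heq {d : G.CodeVar S T R → F} (hd : Set.EqOn d c sᶜ) :
        edmondsMatrix d i = edmondsMatrix c i :=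
      Matrix.ext fun p q' => hcol hd p q' (Option.some_ne_none q')
    rw [heq h', heq h'', sub_self, smul_zero, add_zero, sub_self, mul_zero, add_zero]
  | some q =>
    exact det_add_smul_sub_of_eq_off_col (j := q) (fun p q' hq => hcol h' p q' (by simpa using hq))
      (fun p q' hq => hcol h'' p q' (by simpa using hq)) t

theorem Acyclic.affineIn_singleton_det_systemMatrix (hG : G.Acyclic) {i : Fin N}
    (v : G.CodeVar S T R) :
    AffineIn {v} fun c : G.CodeVar S T R → F => (systemMatrix c i).det := by
  by_cases hv : ∃ q, v.target = Sum.map id (Prod.mk i) q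
  · obtain ⟨q, hq⟩ := hv
    refine hG.affineIn_det_systemMatrix (some q) fun w hw q' hq' => congrArg some ?_
    rw [Set.mem_singleton_iff.1 hw, hq] at hq'
    exact (Sum.map_injective.2 ⟨Function.injective_id, Prod.mk_right_injective i⟩ hq').symm
  · exact hG.affineIn_det_systemMatrix none fun w hw q' hq' =>
      absurd ⟨q', Set.mem_singleton_iff.1 hw ▸ hq'⟩ hv

theorem Acyclic.affineIn_det_receptionMatrix_mul (hG : G.Acyclic) {i : Fin N}
    (B : Matrix (G.InPort (T i)) (Fin R) F) (e : O) :
    AffineIn {v | v.target = Sum.inl e}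
      fun c : G.CodeVar S T R → F => (receptionMatrix c i * B).det := by
  obtain ⟨d, rfl⟩ := exists_decodingMatrix_eq (S := S) B
  have haff : AffineIn {v | v.target = Sum.inl e}
      fun c : G.CodeVar S T R → F => (systemMatrix c i).det :=
    hG.affineIn_det_systemMatrix (some (Sum.inl e)) fun v (hv : v.target = _) q hq => by
      cases q <;> simp_all
  let D : Set (G.CodeVar S T R) := {v | ∃ p, v.target = Sum.inr p}
  convert haff.comp_piecewise D d using 3 with c
  rw [hG.systemMatrix_eq]
  congr 1
  · refine dependsOn_receptionMatrix i fun v ⟨e, _, he⟩ => ?_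
    have hv : v ∉ D := fun ⟨p, hp⟩ => Sum.inl_ne_inr (he.symm.trans hp)
    exact (Set.piecewise_eq_of_notMem D d c hv).symm
  · refine dependsOn_decodingMatrix i fun v ⟨k, hk⟩ => ?_
    exact (Set.piecewise_eq_of_mem D d c ⟨_, hk⟩).symm

section Unicast

theorem Acyclic.exists_systemMatrix_eq_one [Finite V] [Infinite F] (hG : G.Acyclic) {i : Fin N}
    (hT : T i ≠ S)
    (hcut : CutsHaveRank G.inNode G.outNode S (T i) R ∅ (G.edgeMatrix F)) :
    ∃ c : G.CodeVar S T R → F, systemMatrix c i = 1 := by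
  obtain ⟨ρ, hρ⟩ := hG.exists_lt_of_link
  have hρE (e : O) (e' : I) (h : G.edgeMatrix F e e' ≠ 0) :
      ρ (G.outNode e) < ρ (G.inNode e') :=
    hρ _ _ ⟨_, mem_edges_of_edgeMatrix_ne_zero h, rfl, rfl⟩
  obtain ⟨β, X, hβ, hX, hrank⟩ := exists_local_le_rank_of_cutsHaveRank hρE hT.symm hcut
  obtain ⟨a, b, hab⟩ := le_rank_iff_exists_mul_mul_eq_one.1 hrank
  let c : G.CodeVar S T R → F := Sum.elim (fun p => a p.1 p.2) (Sum.elim (fun p => β p.1.1 p.1.2)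
    fun p => if h : G.inNode p.2.1 = T i then b ⟨p.2.1, h⟩ p.2.2 else 0)
  have hlocal : localMatrix c = β := by
    ext e' e
    by_cases h : G.inNode e' = G.outNode e
    · exact dif_pos h
    · exact (dif_neg h).trans (not_not.1 fun hne => h (hβ e' e (Ne.symm hne)))
  have hpath : pathMatrix c = X := by
    have hXE : X * (1 - localMatrix c * G.edgeMatrix F) = G.edgeMatrix F := by
      rw [hlocal, Matrix.mul_sub, Matrix.mul_one, ← Matrix.mul_assoc, sub_eq_iff_eq_add]
      exact hX
    rw [pathMatrix]
    nth_rw 1 [← hXE]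
    exact Matrix.mul_nonsing_inv_cancel_right _ _ (hG.isUnit_det_one_sub_localMatrix_mul c)
  have hsource : (sourceMatrix c).submatrix id Subtype.val = a := by
    ext k e
    exact dif_pos e.2
  have hdec : decodingMatrix c i = b := by
    ext e' k
    exact dif_pos e'.2
  refine ⟨c, ?_⟩
  rw [hG.systemMatrix_eq, receptionMatrix, hpath, hdec, ← hab,
    mul_eq_submatrix_mul_submatrix (G.outNode · = S) fun k e e' h => ?_, hsource]
  · rfl
  · rw [sourceMatrix, Matrix.of_apply, dif_neg h, zero_mul]

theorem Acyclic.exists_isUnit_systemMatrix [Finite V] (hG : G.Acyclic) {i : Fin N}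
    (hT : T i ≠ S) (hcut : R ≤ G.mincut F S (T i)) :
    ∃ c : G.CodeVar S T R → F, IsUnit (systemMatrix c i) := by
  let f := algebraMap F (AlgebraicClosure F)
  have hcutK :
      CutsHaveRank G.inNode G.outNode S (T i) R ∅ (G.edgeMatrix (AlgebraicClosure F)) := by
    rw [← edgeMatrix_map f]
    exact CutsHaveRank.map f (cutsHaveRank_edgeMatrix hcut)
  obtain ⟨c, hc⟩ : ∃ c : G.CodeVar S T R → AlgebraicClosure F, systemMatrix c i = 1 :=
    hG.exists_systemMatrix_eq_one hT hcutK
  have hdet : (systemMatrix c i).det ≠ 0 := by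
    rw [hc, Matrix.det_one]
    exact one_ne_zero
  obtain ⟨c₁, h01, hc₁⟩ := exists_zero_one_ne_zero_of_affineIn
    (hG.affineIn_singleton_det_systemMatrix (i := i)) hdet
  have hlift (v : G.CodeVar S T R) : ∃ a : F, f a = c₁ v := by
    obtain h | h := h01 v
    · exact ⟨0, by rw [h, map_zero]⟩
    · exact ⟨1, by rw [h, map_one]⟩
  choose c₂ hc₂ using hlift
  obtain rfl : f ∘ c₂ = c₁ := funext hc₂
  refine ⟨c₂, (Matrix.isUnit_iff_isUnit_det _).2 (isUnit_iff_ne_zero.2 fun h0 => hc₁ ?_)⟩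
  rw [← hG.det_edmondsMatrix] at h0 ⊢
  rw [edmondsMatrix_map, ← RingHom.mapMatrix_apply, ← RingHom.map_det, h0, map_zero]

end Unicast

end Coding

section RandomCoding

/-- The links counted by `numRandomLinks`. -/
def randomLinks (J : Set (G.CodeVar S T R)) : Set O :=
  {e | (∃ e', (e, e') ∈ G.edges) ∧ ∃ v ∈ J, v.target = Sum.inl e}

/-- The output processes of `T i` counted by `numRandomOutputs`. -/
def randomOutputs (J : Set (G.CodeVar S T R)) (i : Fin N) : Set (Fin R) :=
  {k | ∃ v ∈ J, v.target = Sum.inr (i, k)}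

theorem card_randomLinks (J : Set (G.CodeVar S T R)) :
    Nat.card (randomLinks J) = numRandomLinks J := by
  refine Nat.card_congr (Equiv.subtypeEquivRight fun e => and_congr_right fun _ => ?_)
  constructor
  · rintro ⟨⟨k, e, h⟩ | ⟨⟨e', e⟩, h⟩ | ⟨i, e', k⟩, hv, hve⟩
    · exact Or.inl ⟨k, Sum.inl_injective hve ▸ h, by cases hve; exact hv⟩
    · exact Or.inr ⟨e', Sum.inl_injective hve ▸ h, by cases hve; exact hv⟩
    · cases hve
  · rintro (⟨k, h, hv⟩ | ⟨e', h, hv⟩)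
    · exact ⟨_, hv, rfl⟩
    · exact ⟨_, hv, rfl⟩

theorem card_randomOutputs_le (J : Set (G.CodeVar S T R)) (i : Fin N) :
    Nat.card (randomOutputs J i) ≤ numRandomOutputs J := by
  refine le_of_eq_of_le ?_ (Finset.le_sup (f := fun i : Fin N => Nat.card {k : Fin R //
    ∃ e' : G.InPort (T i), (CodeVar.ε i e' k : G.CodeVar S T R) ∈ J}) (Finset.mem_univ i))
  refine Nat.card_congr (Equiv.subtypeEquivRight fun k => ?_)
  constructor
  · rintro ⟨v | v | ⟨i, e', k⟩, hv, hvk⟩ <;> cases hvk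
    exact ⟨e', hv⟩
  · rintro ⟨e', hv⟩
    exact ⟨_, hv, rfl⟩

theorem numRandomLinks_le_card_edges (J : Set (G.CodeVar S T R)) :
    numRandomLinks J ≤ G.edges.card := by
  rw [← card_randomLinks]
  let f (e : randomLinks J) : G.edges := ⟨(e.1, e.2.1.choose), e.2.1.choose_spec⟩
  have hf : Function.Injective f := fun e₁ e₂ h =>
    Subtype.ext (congrArg (fun e : G.edges => e.1.1) h)
  simpa using Nat.card_le_card_of_injective f hf

theorem numRandomLinks_le_card [Fintype O] (J : Set (G.CodeVar S T R)) :
    numRandomLinks J ≤ Fintype.card O := by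
  rw [← card_randomLinks, ← Nat.card_eq_fintype_card]
  exact Nat.card_le_card_of_injective _ Subtype.val_injective

theorem numRandomOutputs_le {n : ℕ} (J : Set (G.CodeVar S T R)) (hR : ∀ _ : Fin N, R ≤ n) :
    numRandomOutputs J ≤ n := by
  refine Finset.sup_le fun i _ => le_trans ?_ (hR i)
  simpa using Nat.card_le_card_of_injective (Subtype.val : {k : Fin R //
    ∃ e' : G.InPort (T i), (CodeVar.ε i e' k : G.CodeVar S T R) ∈ J} → Fin R) Subtype.val_injective

theorem exists_of_randomCodeProb_pos {J : Set (G.CodeVar S T R)} {c₀ : G.CodeVar S T R → F}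
    {P : (G.CodeVar S T R → F) → Prop} (h : 0 < randomCodeProb J c₀ P) : ∃ c, P c := by
  by_contra! hP
  simp [randomCodeProb, hP] at h

variable [Field F]

theorem le_card_of_le_mincut [Fintype I] [DecidableEq V] [DecidableEq I] [DecidableEq O] {t : V}
    (ht : t ≠ S) (hcut : R ≤ G.mincut F S t) : R ≤ Fintype.card I := by
  have hsource : G.mincut F S t ≤ (G.cutMatrix F {S}).rank :=
    Nat.sInf_le ⟨{S}, Finset.mem_singleton_self S, by simpa using ht, rfl⟩
  calc R ≤ (G.cutMatrix F {S}).rank := hcut.trans hsource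
    _ ≤ Fintype.card {e' : I // G.inNode e' ∉ ({S} : Finset V)} := Matrix.rank_le_card_width _
    _ ≤ Fintype.card I := Fintype.card_subtype_le _

variable [Fintype F]

theorem pow_le_randomCodeProb [Finite I] [Finite O] {κ : Type*} [Finite κ]
    {J Z : Set (G.CodeVar S T R)} {s : κ → Set (G.CodeVar S T R)}
    {h : Fin N → (G.CodeVar S T R → F) → F} (hJ : J ⊆ Z ∪ ⋃ k, s k) (hN : N ≤ Fintype.card F)
    (hZ : ∀ i, DependsOn (h i) Zᶜ) (hs : ∀ k i, AffineIn (s k) (h i)) {c₀ : G.CodeVar S T R → F}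
    (hne : ∀ i, ∃ c, AgreeOff J c₀ c ∧ h i c ≠ 0) {P : (G.CodeVar S T R → F) → Prop}
    (hP : ∀ c, (∀ i, h i c ≠ 0) → P c) :
    (1 - (N : ℝ) / Fintype.card F) ^ Nat.card κ ≤ randomCodeProb J c₀ P := by
  classical
  have := Fintype.ofFinite I
  have := Fintype.ofFinite O
  have := Fintype.ofFinite κ
  have hdraws : Nat.card {c // AgreeOff J c₀ c} = (redraws J c₀).card :=
    Nat.subtype_card _ fun _ => mem_redraws
  have hevent : Nat.card {c // AgreeOff J c₀ c ∧ P c} = ((redraws J c₀).filter P).card :=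
    Nat.subtype_card _ fun _ => by rw [Finset.mem_filter, mem_redraws]; rfl
  have hpos : (0 : ℝ) < (redraws J c₀).card := by exact_mod_cast card_redraws_pos J c₀
  rw [randomCodeProb, hdraws, hevent, le_div_iff₀ hpos, Nat.card_eq_fintype_card]
  have hbound := pow_card_mul_card_redraws_le hJ (by simpa using hN) hZ hs c₀
    fun i => (hne i).imp fun c hc => ⟨mem_redraws.2 hc.1, hc.2⟩
  rw [Fintype.card_fin] at hbound
  refine hbound.trans ?_
  exact_mod_cast Finset.card_le_card (Finset.monotone_filter_right _ fun c _ hc => hP c hc)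

variable [Fintype I] [Fintype O] [DecidableEq V] [DecidableEq I] [DecidableEq O]

theorem Acyclic.pow_le_randomCodeProb_canDecode (hG : G.Acyclic) (hN : N ≤ Fintype.card F)
    {J : Set (G.CodeVar S T R)} {c₀ : G.CodeVar S T R → F}
    (hne : ∀ i, ∃ c, AgreeOff J c₀ c ∧ CanDecode c i) :
    (1 - (N : ℝ) / Fintype.card F) ^ numRandomLinks J ≤
      randomCodeProb J c₀ fun c => ∀ i, CanDecode c i := by
  choose w hw hdec using hne
  choose B hB using fun i => hG.canDecode_iff_exists_det_ne_zero.1 (hdec i)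
  have hJ : J ⊆ linkVarsᶜ ∪ ⋃ e : randomLinks J, {v | v.target = Sum.inl e.1} := by
    intro v hv
    by_cases hlink : v ∈ linkVars
    · obtain ⟨e, he, hve⟩ := hlink
      exact Or.inr (Set.mem_iUnion.2 ⟨⟨e.1, ⟨e.2, he⟩, v, hv, hve⟩, hve⟩)
    · exact Or.inl hlink
  have hZ (i : Fin N) : DependsOn (fun c : G.CodeVar S T R → F => (receptionMatrix c i * B i).det)
      linkVarsᶜᶜ := by
    rw [compl_compl]
    exact fun c c' h => congrArg (fun X => (X * B i).det) (dependsOn_receptionMatrix i h)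
  rw [← card_randomLinks]
  exact pow_le_randomCodeProb hJ hN hZ
    (fun e i => hG.affineIn_det_receptionMatrix_mul (B i) e.1)
    (fun i => ⟨w i, hw i, hB i⟩) fun c hc i => hG.canDecode_iff_exists_det_ne_zero.2 ⟨B i, hc i⟩

theorem Acyclic.pow_le_randomCodeProb_isUnit (hG : G.Acyclic) (hN : N ≤ Fintype.card F)
    {J : Set (G.CodeVar S T R)} {c₀ : G.CodeVar S T R → F}
    (hne : ∀ i, ∃ c, AgreeOff J c₀ c ∧ IsUnit (systemMatrix c i)) :
    (1 - (N : ℝ) / Fintype.card F) ^ (numRandomLinks J + numRandomOutputs J) ≤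
      randomCodeProb J c₀ fun c => ∀ i, IsUnit (systemMatrix c i) := by
  -- `M i` involves only the coefficients of its own destination, so one group of variables can hold
  -- the coefficients of one random output of each destination, chosen by `g`.
  choose g hg using fun i => exists_forall_mem_exists_eq_some (card_randomOutputs_le J i)
  let s : randomLinks J ⊕ Fin (numRandomOutputs J) → Set (G.CodeVar S T R) :=
    Sum.elim (fun e => {v | v.target = Sum.inl e.1})
      fun j => {v | ∃ i k, g i j = some k ∧ v.target = Sum.inr (i, k)}
  have hJ : J ⊆ (linkVars ∪ {v | ∃ p, v.target = Sum.inr p})ᶜ ∪ ⋃ k, s k := by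
    intro v hv
    by_cases hactive : v ∈ linkVars ∪ {v | ∃ p, v.target = Sum.inr p}
    · refine Or.inr (Set.mem_iUnion.2 ?_)
      obtain ⟨e, he, hve⟩ | ⟨⟨i, k⟩, hvk⟩ := hactive
      · exact ⟨Sum.inl ⟨e.1, ⟨e.2, he⟩, v, hv, hve⟩, hve⟩
      · obtain ⟨j, hj⟩ := hg i k ⟨v, hv, hvk⟩
        exact ⟨Sum.inr j, i, k, hj, hvk⟩
    · exact Or.inl hactive
  have hZ (i : Fin N) : DependsOn (fun c : G.CodeVar S T R → F => (systemMatrix c i).det)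
      (linkVars ∪ {v | ∃ p, v.target = Sum.inr p})ᶜᶜ := by
    rw [compl_compl]
    exact fun c c' h => congrArg Matrix.det (hG.dependsOn_systemMatrix i fun v hv =>
      h v (hv.imp_right fun ⟨k, hk⟩ => ⟨(i, k), hk⟩))
  have hs (k : randomLinks J ⊕ Fin (numRandomOutputs J)) (i : Fin N) :
      AffineIn (s k) fun c : G.CodeVar S T R → F => (systemMatrix c i).det := by
    rcases k with e | j
    · refine hG.affineIn_det_systemMatrix (some (Sum.inl e.1))
        fun v (hv : v.target = _) q hq => ?_
      cases q <;> simp_all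
    · refine hG.affineIn_det_systemMatrix ((g i j).map Sum.inr) fun v ⟨i', k, hk, hv⟩ q hq => ?_
      cases q <;> simp_all
  rw [← card_randomLinks, ← Nat.card_fin (numRandomOutputs J), ← Nat.card_sum]
  simp only [Matrix.isUnit_iff_isUnit_det, isUnit_iff_ne_zero] at hne ⊢
  exact pow_le_randomCodeProb hJ hN hZ hs hne fun c hc => hc

theorem Acyclic.exists_forall_isUnit_systemMatrix [Finite V] (hG : G.Acyclic)
    (hT : ∀ i, T i ≠ S) (hN : N < Fintype.card F) (hcut : ∀ i, R ≤ G.mincut F S (T i)) :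
    ∃ c : G.CodeVar S T R → F, ∀ i, IsUnit (systemMatrix c i) := by
  have hne (i : Fin N) : ∃ c : G.CodeVar S T R → F,
      AgreeOff Set.univ 0 c ∧ IsUnit (systemMatrix c i) :=
    (hG.exists_isUnit_systemMatrix (hT i) (hcut i)).imp fun c hc =>
      ⟨fun v hv => absurd (Set.mem_univ v) hv, hc⟩
  refine exists_of_randomCodeProb_pos
    ((pow_pos ?_ _).trans_le (hG.pow_le_randomCodeProb_isUnit hN.le hne))
  have hlt : (N : ℝ) < Fintype.card F := by exact_mod_cast hN
  exact sub_pos.2 ((div_lt_one ((Nat.cast_nonneg N).trans_lt hlt)).2 hlt)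

end RandomCoding

end ADTNetwork

theorem mainTheorem10 {V I O : Type*} [Fintype V] [Fintype I] [Fintype O]
    [DecidableEq V] [DecidableEq I] [DecidableEq O] {F : Type*} [Field F] [Fintype F]
    (G : ADTNetwork V I O) (hG : G.Acyclic)
    (S : V) (N : ℕ) (T : Fin N → V) (hT : ∀ i, T i ≠ S) (R : ℕ)
    (hq : N < Fintype.card F) (hcut : ∀ i, R ≤ G.mincut F S (T i)) :
    -- the multicast is solvable
    (∃ c : G.CodeVar S T R → F, ∀ i, IsUnit (ADTNetwork.systemMatrix c i)) ∧
    -- the variables in `J` are random, the others keep their values in `c₀`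
    ∀ (J : Set (G.CodeVar S T R)) (c₀ : G.CodeVar S T R → F),
      -- every destination can recover the source symbols from what it receives
      ((∀ i, ∃ c, ADTNetwork.AgreeOff J c₀ c ∧ ADTNetwork.CanDecode c i) →
        (1 - (N : ℝ) / (Fintype.card F : ℝ)) ^ ADTNetwork.numRandomLinks J ≤
          ADTNetwork.randomCodeProb J c₀ (fun c => ∀ i, ADTNetwork.CanDecode c i)) ∧
      -- the system matrix, formed with the drawn decoding coefficients, is invertible
      ((∀ i, ∃ c, ADTNetwork.AgreeOff J c₀ c ∧ IsUnit (ADTNetwork.systemMatrix c i)) →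
        (1 - (N : ℝ) / (Fintype.card F : ℝ)) ^
            (ADTNetwork.numRandomLinks J + ADTNetwork.numRandomOutputs J) ≤
          ADTNetwork.randomCodeProb J c₀
            (fun c => ∀ i, IsUnit (ADTNetwork.systemMatrix c i))) ∧
      ADTNetwork.numRandomLinks J ≤ G.edges.card ∧
      ADTNetwork.numRandomLinks J + ADTNetwork.numRandomOutputs J ≤
        Fintype.card I + Fintype.card O := by
  refine ⟨hG.exists_forall_isUnit_systemMatrix hT hq hcut, fun J c₀ =>
    ⟨hG.pow_le_randomCodeProb_canDecode hq.le, hG.pow_le_randomCodeProb_isUnit hq.le,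
      ADTNetwork.numRandomLinks_le_card_edges J, ?_⟩⟩
  rw [add_comm]
  exact add_le_add
    (ADTNetwork.numRandomOutputs_le J fun i => ADTNetwork.le_card_of_le_mincut (hT i) (hcut i))
    (ADTNetwork.numRandomLinks_le_card J)
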